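/- **Setting.** Let $V\subset\mathbb P^n(\mathbb C)$ be a projective algebraic subset of dimension $k\ge 1$, with homogeneous ideal $I(V)$; let $d\ge 1$, let $I_d(V)=\mathbb C[x_0,\dots,x_n]_d/(I(V)\cap\mathbb C[x_0,\dots,x_n]_d)$, let $M=\dim I_d(V)-1$, and fix an ordered basis $\mathcal V=([v_0],\dots,[v_M])$ of $I_d(V)$, where the $v_i$ are forms of degree $d$. Let $N\ge k$ and let $Q_1,\dots,Q_q$ be nonzero forms of degree $d$ in $N$-subgeneral position with respect to $V$ (no point of $V$ is a common zero of $N+1$ of them), with $$q>\frac{(2N-k+1)(M+1)}{k+1}.$$ Write $[Q_j]=\sum_{l=0}^M a_{jl}[v_l]$. Let $\omega_1,\dots,\omega_q$ be Nochka weights for the $Q_j$ and $\tilde\omega=\max_j\omega_j$ the Nochka constant; that is, (i) $0<\omega_j\le 1$; (ii) $\sum_{j=1}^q\omega_j=\tilde\omega(q-2N+k-1)+k+1$; (iii) $\frac{k+1}{2N-k+1}\le\tilde\omega\le\frac kN$; (iv) $\sum_{j\in R}\omega_j\le k+1$ whenever $R\subset\{1,\dots,q\}$ and $\# R=N+1$;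 (v) for all real $E_1,\dots,E_q\ge 1$ and all $R\subset\{1,\dots,q\}$ with $\# R=N+1$ there is $R^o\subset R$ with $\# R^o=k+1=\operatorname{rank}\{[Q_i]\}_{i\in R^o}$ (the rank in $I_d(V)$) and $\prod_{i\in R}E_i^{\omega_i}\le\prod_{i\in R^o}E_i$. Let $f:S\to V\subset\mathbb P^n(\mathbb C)$ be a holomorphic map from a (connected) Riemann surface $S$ that is nondegenerate over $I_d(V)$: no form $P$ of degree $d$ with $[P]\ne 0$ in $I_d(V)$ vanishes identically along $f$. Let $(U,z)$ be a holomorphic chart of $S$ and $F=(f_0,\dots,f_n)$ a reduced representation of $f$ on $U$ (the $f_i$ are holomorphic on $U$ without common zero, and $f=(f_0:\dots:f_n)$). With Wronskians $W$ taken with respect to $z$, put $$|F_{\mathcal V,p}|=\Big(\sum_{0\le i_0<\dots<i_p\le M}\big|W(v_{i_0}(F),\dots,v_{i_p}(F))\big|^2\Big)^{1/2},$$ $$|F_{\mathcal V,p}(Q_j)|=\Big(\sum_{0\le i_1<\dots<i_p\le M}\Big|\sum_{l\ne i_1,\dots,i_p}a_{jl}\,W(v_l(F),v_{i_1}(F),\dots,v_{i_p}(F))\Big|^2\Big)^{1/2},$$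 $$\varphi_{\mathcal V,p}(Q_j)=\frac{|F_{\mathcal V,p}(Q_j)|}{|F_{\mathcal V,p}|},$$ so that $|F_{\mathcal V,0}(Q_j)|=|Q_j(F)|$. Let $dd^c=\frac{\sqrt{-1}}{2\pi}\partial\bar\partial$. **Theorem 3.3.** For every $\epsilon>0$ there exist constants $\delta>1$ and $C>0$, depending only on $\mathcal V$, $\epsilon$ and the $Q_j$ with their weights $\omega_j$ (and hence not on $S$, $f$, $(U,z)$ or $F$), such that at every point of $U$ at which $|F_{\mathcal V,p}|\ne 0$ and $|F_{\mathcal V,p}(Q_j)|\neq 0$ for all $1\le j\le q$ and $0\le p\le M-1$, one has $\varphi_{\mathcal V,p}(Q_j)<\delta$ for all these $j,p$, and $$dd^c\log\frac{\prod_{p=0}^{M-1}|F_{\mathcal V,p}|^{2\epsilon}}{\prod_{1\le j\le q,\,0\le p\le M-1}\log^{2\omega_j}\big(\delta/\varphi_{\mathcal V,p}(Q_j)\big)}\ \ge\ C\left(\frac{|F_{\mathcal V,0}|^{2(\tilde\omega(q-(2N-k+1))-M+k)}\,|F_{\mathcal V,M}|^2}{\prod_{j=1}^q\Big(|F_{\mathcal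 V,0}(Q_j)|^2\prod_{p=0}^{M-1}\log^2\big(\delta/\varphi_{\mathcal V,p}(Q_j)\big)\Big)^{\omega_j}}\right)^{\frac{2}{M(M+1)}}dd^c|z|^2 .$$ -/

import Mathlib

open scoped Manifold ContDiff LinearAlgebra.Projectivization

universe u

noncomputable section

namespace GaussMap

/-- Complex projective space of dimension `n`. -/
abbrev PSpace (n : ℕ) : Type := ℙ ℂ (Fin (n + 1) → ℂ)

/-- The polynomial `P` vanishes at the point `x` of projective space. It is used for homogeneous
`P` only, where it does not depend on the chosen representative of `x`. -/
def VanishesAt {n : ℕ} (P : MvPolynomial (Fin (n + 1)) ℂ) (x : PSpace n) : Prop :=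
  MvPolynomial.eval x.rep P = 0

/-- `V` is a projective algebraic subset: the common zero set of a family of homogeneous
polynomials. -/
def IsProjectiveAlgebraic {n : ℕ} (V : Set (PSpace n)) : Prop :=
  ∃ A : Set (MvPolynomial (Fin (n + 1)) ℂ),
    (∀ P ∈ A, ∃ m : ℕ, P.IsHomogeneous m) ∧ V = {x | ∀ P ∈ A, VanishesAt P x}

/-- The homogeneous ideal `I(V)`, generated by all homogeneous polynomials vanishing on `V`. -/
def vanishingIdeal {n : ℕ} (V : Set (PSpace n)) : Ideal (MvPolynomial (Fin (n + 1)) ℂ) :=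
  Ideal.span {P | (∃ m : ℕ, P.IsHomogeneous m) ∧ ∀ x ∈ V, VanishesAt P x}

/-- `V` has dimension `k`: its homogeneous coordinate ring has Krull dimension `k + 1`. -/
def HasDimension {n : ℕ} (V : Set (PSpace n)) (k : ℕ) : Prop :=
  ringKrullDim (MvPolynomial (Fin (n + 1)) ℂ ⧸ vanishingIdeal V) = ((k + 1 : ℕ) : WithBot ℕ∞)

/-- `ℂ[x₀, …, xₙ]_d`, the homogeneous polynomials of degree `d` together with zero. -/
abbrev Forms (n d : ℕ) : Submodule ℂ (MvPolynomial (Fin (n + 1)) ℂ) :=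
  MvPolynomial.homogeneousSubmodule (Fin (n + 1)) ℂ d

/-- The degree `d` part of `I(V)`, as a subspace of the forms of degree `d`. -/
def vanishingForms {n : ℕ} (V : Set (PSpace n)) (d : ℕ) : Submodule ℂ (Forms n d) :=
  ((vanishingIdeal V).restrictScalars ℂ).comap (Forms n d).subtype

/-- `I_d(V) = ℂ[x₀, …, xₙ]_d / (I(V) ∩ ℂ[x₀, …, xₙ]_d)`. -/
abbrev FormClasses {n : ℕ} (V : Set (PSpace n)) (d : ℕ) : Type :=
  Forms n d ⧸ vanishingForms V d

/-- The class `[P]` in `I_d(V)` of a form `P` of degree `d`. -/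
def formClass {n : ℕ} (V : Set (PSpace n)) {d : ℕ} (P : Forms n d) : FormClasses V d :=
  Submodule.Quotient.mk P

/-- The hypersurfaces `Q_j` are in `N`-subgeneral position with respect to `V`: no point of `V`
lies on `N + 1` of them. -/
def InSubgeneralPosition {n d q : ℕ} (V : Set (PSpace n)) (N : ℕ) (Q : Fin q → Forms n d) :
    Prop :=
  ∀ R : Finset (Fin q), R.card = N + 1 → ¬ ∃ x ∈ V, ∀ j ∈ R, VanishesAt (Q j).1 x

/-- The Nochka constant `ω̃ = max_j ω_j` of the weights `ω_j`. -/
def nochkaConstant {q : ℕ} (wt : Fin q → ℝ) : ℝ := ⨆ j, wt j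

/-- `wt = (ω_1, …, ω_q)` is a system of Nochka weights for the hypersurfaces `Q_j` in
`N`-subgeneral position with respect to the `k`-dimensional `V`. The rank in the last condition is taken in `I_d(V)`. -/
structure IsNochkaWeights {n d q : ℕ} (V : Set (PSpace n)) (k N : ℕ) (Q : Fin q → Forms n d)
    (wt : Fin q → ℝ) : Prop where
  pos : ∀ j, 0 < wt j
  le_one : ∀ j, wt j ≤ 1
  sum_eq : ∑ j, wt j = nochkaConstant wt * ((q : ℝ) - 2 * N + k - 1) + k + 1
  le_const : ((k : ℝ) + 1) / (2 * N - k + 1) ≤ nochkaConstant wt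
  const_le : nochkaConstant wt ≤ (k : ℝ) / N
  sum_le : ∀ R : Finset (Fin q), R.card = N + 1 → ∑ j ∈ R, wt j ≤ (k : ℝ) + 1
  prod_le : ∀ E : Fin q → ℝ, (∀ j, 1 ≤ E j) → ∀ R : Finset (Fin q), R.card = N + 1 →
    ∃ R' ⊆ R, R'.card = k + 1 ∧
      Module.finrank ℂ (Submodule.span ℂ ((fun j => formClass V (Q j)) '' (R' : Set (Fin q))))
        = k + 1 ∧
      ∏ j ∈ R, E j ^ wt j ≤ ∏ j ∈ R', E j

section Curves

variable {S : Type*} [TopologicalSpace S]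

/-- `F = (f₀, …, fₙ)` is a reduced representation of `f` in the chart `e`, written in the
coordinate `z ∈ e.target`: the `f_i` are holomorphic, have no common zero, and
`f = (f₀ : ⋯ : fₙ)`. -/
structure IsReducedRepresentation {n : ℕ} (f : S → PSpace n) (e : OpenPartialHomeomorph S ℂ)
    (F : ℂ → Fin (n + 1) → ℂ) : Prop where
  holomorphic : DifferentiableOn ℂ F e.target
  represents : ∀ z ∈ e.target, ∃ h : F z ≠ 0, f (e.symm z) = Projectivization.mk ℂ (F z) h

/-- `f` is a holomorphic map from the Riemann surface `S` to projective space: it has reduced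
representations locally. -/
def IsHolomorphicCurve [ChartedSpace ℂ S] {n : ℕ} (f : S → PSpace n) : Prop :=
  ∀ s : S, ∃ e ∈ IsManifold.maximalAtlas 𝓘(ℂ) ω S, s ∈ e.source ∧
    ∃ F : ℂ → Fin (n + 1) → ℂ, IsReducedRepresentation f e F

/-- `f` is nondegenerate over `I_d(V)`: no form `P` of degree `d` with `[P] ≠ 0` vanishes
identically along `f`. -/
def IsNondegenerateOver {n : ℕ} (f : S → PSpace n) (V : Set (PSpace n)) (d : ℕ) : Prop :=
  ∀ P : Forms n d, formClass V P ≠ 0 → ∃ s : S, ¬ VanishesAt P.1 (f s)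

end Curves

section Contact

/-- The components `v_i(F)` of `F_𝒱 = (v₀(F), …, v_M(F))`. -/
def liftedCurve {n d M : ℕ} (v : Fin (M + 1) → Forms n d) (F : ℂ → Fin (n + 1) → ℂ) :
    Fin (M + 1) → ℂ → ℂ :=
  fun i z => MvPolynomial.eval (F z) (v i).1

/-- The Wronskian `det (g_j^{(l)}(z))` of functions `g_0, …, g_{m-1}`. -/
def wronskianAt {m : ℕ} (g : Fin m → ℂ → ℂ) (z : ℂ) : ℂ :=
  (Matrix.of fun l j : Fin m => iteratedDeriv (l : ℕ) (g j) z).det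

open Classical in
/-- `|F_{𝒱,p}|` for the curve `g = F_𝒱`: the norm of `g ∧ g' ∧ ⋯ ∧ g^{(p)}`, whose coordinates are
the Wronskians `W(g_{i_0}, …, g_{i_p})` with `i_0 < ⋯ < i_p`. -/
def derivedNorm {M : ℕ} (g : Fin (M + 1) → ℂ → ℂ) (p : ℕ) (z : ℂ) : ℝ :=
  √(∑ I : {I : Fin (p + 1) → Fin (M + 1) // StrictMono I},
    ‖wronskianAt (fun j => g (I.1 j)) z‖ ^ 2)

open Classical in
/-- `|F_{𝒱,p}(Q)|` for the curve `g = F_𝒱` and `[Q] = ∑ a_l [v_l]`: the norm of the contraction of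
`g ∧ g' ∧ ⋯ ∧ g^{(p)}` with `a`, whose coordinates are `∑_l a_l W(g_l, g_{i_1}, …, g_{i_p})` with
`i_1 < ⋯ < i_p`. The terms with `l` among the `i_r` vanish. For `p = 0` this is `|Q(F)|`. -/
def contactNorm {M : ℕ} (g : Fin (M + 1) → ℂ → ℂ) (a : Fin (M + 1) → ℂ) (p : ℕ) (z : ℂ) : ℝ :=
  √(∑ I : {I : Fin p → Fin (M + 1) // StrictMono I},
    ‖∑ l, a l * wronskianAt (Fin.cons (g l) fun r => g (I.1 r)) z‖ ^ 2)

/-- The contact function `φ_{𝒱,p}(Q) = |F_{𝒱,p}(Q)| / |F_{𝒱,p}|`. -/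
def contactFunction {M : ℕ} (g : Fin (M + 1) → ℂ → ℂ) (a : Fin (M + 1) → ℂ) (p : ℕ) (z : ℂ) : ℝ :=
  contactNorm g a p z / derivedNorm g p z

end Contact

/-- `dd^c u = (i / 2π) ∂∂̄ u` in the coordinate `z = x + i y`, for `u` of class `C²` near `z`: the
coefficient `Δu / 4π` of `dx ∧ dy`. An inequality between real `(1,1)`-forms on a plane domain is
the inequality between these coefficients. -/
def ddc (u : ℂ → ℝ) (z : ℂ) : ℝ := 1 / (4 * Real.pi) * Laplacian.laplacian u z

end GaussMap

end

/-! At a given point let y_0, y_1, … be the unnormalised Gram–Schmidt vectors of the jet of g = F_𝒱.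
Put t_l = |y_l|², let τ_{j,l} be the `lineContact` of Q_j with y_l, and Θ_{j,m} = ∑_{l<m} τ_{j,l}.
Then |F_p|² = t_0⋯t_p, φ_p(Q_j)² = Θ_{j,p+1}, and dd^c log|F_p|² = Ω_p dd^c|z|² with Ω_p =
t_{p+1}/t_p.

The same frame gives the Levi form of -2 log log(δ/φ_p) in closed form
(`exists_hasLeviData_neg_log_log`). With ℓ = log(δ/φ_p) ≥ 1 and Ξ_{j,p} = φ_{p+1}²/(φ_p²ℓ²) it is at
least Ω_p(Ξ_{j,p}/2 - 3/(2ℓ)). A large δ makes every ℓ large, and the negative terms are absorbed by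
ε log|F_p|². The dd^c in the theorem is thus at least Λ dd^c|z|², where Λ = ∑_p Ω_p(ε/2 + ½∑_j
ω_jΞ_{j,p}) (`ddc_log_quotient_ge`).

The Nochka weights give ∏_j Ξ_{j,p}^{ω_j} ≤ K(1 + ∑_j Ξ_{j,p})^{M-p}
(`IsNochkaWeights.exists_prod_ratio_le`). By compactness of V, among any N+1 of the Q_j some
φ_0(Q_j) is bounded below, so the indices with large Ξ fit into one set R of N+1 elements. Moreover
M-p+1 linearly independent functionals cannot all be small on the span of y_0, …, y_p, so at most
M-p indices of R^o are large.

Multiplied over p, both sides telescope: ∏Ω_p^{M-p} = |F_M|²/|F_0|^{2(M+1)} and ∏_pΞ_{j,p} =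
φ_M²/(φ_0²∏ℓ²), with φ_M bounded below. Since ∑(M-p) = M(M+1)/2, the quotient in the theorem is at
most a constant times Λ^{M(M+1)/2} (`weighted_quotient_le`). -/

noncomputable section

namespace GaussMap

open Matrix Finset

/-! ### Determinants: Cauchy–Binet and unitriangular row changes -/

section CauchyBinet

variable {R : Type*} [CommRing R] {m n : ℕ}

/-- Multilinearity in the columns: column i of `A * B` is a combination of the columns of `A`, and
`f i` records which one is taken. -/
theorem det_mul_eq_sum_fun (A : Matrix (Fin m) (Fin n) R) (B : Matrix (Fin n) (Fin m) R) :
    (A * B).det = ∑ f : Fin m → Fin n, (∏ i, B (f i) i) * (A.submatrix id f).det := by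
  simp only [det_apply', mul_apply, prod_univ_sum, mul_sum, Fintype.piFinset_univ]
  rw [sum_comm]
  refine sum_congr rfl fun f _ => sum_congr rfl fun σ _ => ?_
  simp only [prod_mul_distrib, submatrix_apply, id]
  ring

theorem exists_strictMono_comp_perm {f : Fin m → Fin n} (hf : Function.Injective f) :
    ∃ (I : Fin m → Fin n) (σ : Equiv.Perm (Fin m)), StrictMono I ∧ I ∘ σ = f := by
  refine ⟨f ∘ Tuple.sort f, (Tuple.sort f)⁻¹, ?_, ?_⟩
  · exact (Tuple.monotone_sort f).strictMono_of_injective (hf.comp (Tuple.sort f).injective)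
  · ext i; simp

/-- The Cauchy–Binet formula. -/
theorem det_mul_eq_sum_strictMono (A : Matrix (Fin m) (Fin n) R) (B : Matrix (Fin n) (Fin m) R)
    [Fintype {I : Fin m → Fin n // StrictMono I}] :
    (A * B).det = ∑ I : {I : Fin m → Fin n // StrictMono I},
      (A.submatrix id I.1).det * (B.submatrix I.1 id).det := by
  have key : ∀ I : {I : Fin m → Fin n // StrictMono I},
      (A.submatrix id I.1).det * (B.submatrix I.1 id).det =
        ∑ σ : Equiv.Perm (Fin m), (∏ i, B ((I.1 ∘ σ) i) i) * (A.submatrix id (I.1 ∘ σ)).det := by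
    intro I
    rw [det_apply' (B.submatrix I.1 id), mul_sum]
    refine sum_congr rfl fun σ _ => ?_
    have : (A.submatrix id (I.1 ∘ σ)).det = Equiv.Perm.sign σ * (A.submatrix id I.1).det := by
      rw [← det_permute' σ]; rfl
    rw [this]
    simp only [submatrix_apply, id, Function.comp]
    ring
  rw [det_mul_eq_sum_fun, sum_congr rfl fun I _ => key I, ← sum_product', univ_product_univ]
  symm
  -- Injective maps correspond to pairs (I, σ) of an increasing map and a permutation; for the
  -- remaining maps `A.submatrix id f` has two equal columns.
  refine sum_of_injOn (fun x => x.1.1 ∘ x.2) ?_ (by simp) ?_ (by simp)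
  · rintro ⟨I, σ⟩ - ⟨J, τ⟩ - h
    simp only at h
    have hIJ : I.1 = J.1 := by
      rw [← I.2.range_inj J.2, ← σ.surjective.range_comp I.1, h, τ.surjective.range_comp]
    have hst : σ = τ := by
      ext i
      have := congrFun h i
      simp only [Function.comp, hIJ] at this
      exact congrArg _ (J.2.injective this)
    rw [Subtype.ext hIJ, hst]
  · intro f _ hf
    have : ¬ Function.Injective f := by
      intro hinj
      obtain ⟨I, σ, hI, h⟩ := exists_strictMono_comp_perm hinj
      exact hf ⟨(⟨I, hI⟩, σ), by simp, h⟩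
    simp only [Function.Injective, not_forall] at this
    obtain ⟨i, j, hij, hne⟩ := this
    rw [det_zero_of_column_eq hne (fun k => by simp [hij]), mul_zero]

end CauchyBinet

section Triangular

variable {R : Type*} [CommRing R] {m n : ℕ}

/-- `X = T * Y` with `T` lower unitriangular. Since `B` is arbitrary, passing from the jet to its
Gram–Schmidt vectors changes neither the Wronskians nor the contractions. -/
theorem det_mul_of_unitriangular {X Y : Matrix (Fin m) (Fin n) R} (c : Fin m → Fin m → R)
    (h : ∀ l, X l = Y l + ∑ i ∈ Iio l, c l i • Y i) (B : Matrix (Fin n) (Fin m) R) :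
    (X * B).det = (Y * B).det := by
  set T : Matrix (Fin m) (Fin m) R := of fun l i => if i < l then c l i else if i = l then 1 else 0
  have hX : X = T * Y := by
    ext l k
    rw [h l, mul_apply]
    have : ∀ i, T l i * Y i k = (if i < l then c l i * Y i k else 0) +
        (if i = l then Y i k else 0) := by
      intro i
      simp only [T, of_apply]
      split_ifs with h1 h2 <;> simp_all
    simp only [this, sum_add_distrib, sum_ite_eq', mem_univ, if_true, Pi.add_apply, Finset.sum_apply,
      Pi.smul_apply, smul_eq_mul]
    rw [add_comm, ← sum_filter]
    congr 2
    ext i; simp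
  have hT : T.det = 1 := by
    rw [det_of_isLowerTriangular T (fun i j hij => ?_)]
    · simp [T]
    · have : i < j := hij
      simp [T, this.not_gt, this.ne']
  rw [hX, Matrix.mul_assoc, det_mul, hT, one_mul]

end Triangular
end GaussMap

namespace GaussMap

open Matrix Finset ComplexConjugate

/-! ### Coordinates of exterior products and contractions -/

section Minors

variable {m n p : ℕ}

/-- The coordinates of the exterior product of the rows of `Y`. -/
def minorDet (Y : Matrix (Fin m) (Fin n) ℂ) (I : Fin m → Fin n) : ℂ := (Y.submatrix id I).det

/-- The matrix whose first column is `a` and whose other columns are the standard basis vectors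
`e_{I r}`. -/
def contactCols (a : Fin n → ℂ) (I : Fin p → Fin n) : Matrix (Fin n) (Fin (p + 1)) ℂ :=
  of fun k => Fin.cons (a k) fun r => if k = I r then 1 else 0

/-- The coordinates of the contraction with `a` of the exterior product of the rows of `Y`. -/
def contraction (Y : Matrix (Fin (p + 1)) (Fin n) ℂ) (a : Fin n → ℂ) (I : Fin p → Fin n) : ℂ :=
  (Y * contactCols a I).det

/-- Minors take the form `(Y * B).det` with `B` constant, the form contractions have by definition,
so that one lemma about `(Y * B).det` serves both. -/
theorem minorDet_eq_det_mul (Y : Matrix (Fin m) (Fin n) ℂ) (I : Fin m → Fin n) :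
    minorDet Y I = (Y * (of fun k r => if k = I r then 1 else 0 : Matrix (Fin n) (Fin m) ℂ)).det := by
  unfold minorDet
  congr 1
  ext l r
  simp [mul_apply]

theorem contraction_eq_sum (Y : Matrix (Fin (p + 1)) (Fin n) ℂ) (a : Fin n → ℂ)
    (I : Fin p → Fin n) :
    contraction Y a I =
      ∑ s : Fin (p + 1), (-1) ^ (s : ℕ) * (Y s ⬝ᵥ a) * minorDet (Y.submatrix s.succAbove id) I := by
  unfold contraction minorDet
  rw [det_succ_column_zero]
  refine sum_congr rfl fun s _ => ?_
  congr 2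
  ext l r
  simp [mul_apply, contactCols]

/-- Cauchy–Binet for `Z * Yᴴ`: the hermitian product of two decomposable multivectors is a Gram
determinant. -/
theorem sum_conj_minorDet_mul [Fintype {I : Fin m → Fin n // StrictMono I}]
    (Y Z : Matrix (Fin m) (Fin n) ℂ) :
    ∑ I : {I : Fin m → Fin n // StrictMono I}, conj (minorDet Y I.1) * minorDet Z I.1 =
      (Z * Yᴴ).det := by
  rw [det_mul_eq_sum_strictMono]
  refine sum_congr rfl fun I _ => ?_
  have : (Yᴴ).submatrix I.1 id = (Y.submatrix id I.1)ᴴ := rfl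
  rw [this, det_conjTranspose, mul_comm]
  rfl

end Minors

/-! ### Norms and products of minors and contractions for orthogonal rows -/

section Orthogonal

variable {m n p : ℕ} {y : ℕ → Fin n → ℂ}

/-- The squared hermitian norm. -/
def normSqSum (x : Fin n → ℂ) : ℝ := ∑ k, ‖x k‖ ^ 2

theorem normSqSum_nonneg (x : Fin n → ℂ) : 0 ≤ normSqSum x := sum_nonneg fun _ _ => by positivity

theorem dotProduct_star_self_eq (x : Fin n → ℂ) : x ⬝ᵥ star x = (normSqSum x : ℂ) := by
  simp [dotProduct, normSqSum, Complex.mul_conj, Complex.normSq_eq_norm_sq]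

theorem normSqSum_eq_zero {x : Fin n → ℂ} (h : normSqSum x = 0) : x = 0 := by
  unfold normSqSum at h
  rw [sum_eq_zero_iff_of_nonneg fun _ _ => by positivity] at h
  ext k
  simpa using h k (mem_univ k)

/-- The matrix with rows `y (σ l)`. -/
def rowsOf (y : ℕ → Fin n → ℂ) (σ : Fin m → ℕ) : Matrix (Fin m) (Fin n) ℂ := of fun l => y (σ l)

/-- The vectors of the sequence are pairwise orthogonal. -/
def IsOrthogonalSeq (y : ℕ → Fin n → ℂ) : Prop := ∀ i j, i ≠ j → y i ⬝ᵥ star (y j) = 0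

@[simp] theorem rowsOf_apply (y : ℕ → Fin n → ℂ) (σ : Fin m → ℕ) (l : Fin m) :
    rowsOf y σ l = y (σ l) := rfl

theorem det_rowsOf_self (hy : IsOrthogonalSeq y) {σ : Fin m → ℕ} (hσ : Function.Injective σ) :
    (rowsOf y σ * (rowsOf y σ)ᴴ).det = ∏ l, (normSqSum (y (σ l)) : ℂ) := by
  have : rowsOf y σ * (rowsOf y σ)ᴴ = diagonal fun l => (normSqSum (y (σ l)) : ℂ) := by
    ext i j
    have h : (rowsOf y σ * (rowsOf y σ)ᴴ) i j = y (σ i) ⬝ᵥ star (y (σ j)) := by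
      simp [mul_apply, rowsOf, dotProduct]
    rw [h]
    rcases eq_or_ne i j with rfl | hij
    · simp [dotProduct_star_self_eq]
    · simp [hij, hy _ _ (hσ.ne hij)]
  rw [this, det_diagonal]

theorem det_rowsOf_eq_zero (hy : IsOrthogonalSeq y) {σ τ : Fin m → ℕ} (j : Fin m) (hj : ∀ i, τ i ≠ σ j) :
    (rowsOf y τ * (rowsOf y σ)ᴴ).det = 0 := by
  refine det_eq_zero_of_column_eq_zero j fun i => ?_
  have h : (rowsOf y τ * (rowsOf y σ)ᴴ) i j = y (τ i) ⬝ᵥ star (y (σ j)) := by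
    simp [mul_apply, rowsOf, dotProduct]
  rw [h, hy _ _ (hj i)]

theorem sum_norm_sq_eq_ofReal {ι : Type*} [Fintype ι] (f : ι → ℂ) :
    ((∑ I, ‖f I‖ ^ 2 : ℝ) : ℂ) = ∑ I, conj (f I) * f I := by
  push_cast
  refine sum_congr rfl fun I _ => ?_
  rw [mul_comm, Complex.mul_conj, Complex.normSq_eq_norm_sq]
  push_cast; rfl

theorem sum_norm_sq_minorDet (hy : IsOrthogonalSeq y) [Fintype {I : Fin m → Fin n // StrictMono I}] {σ : Fin m → ℕ}
    (hσ : Function.Injective σ) :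
    ∑ I : {I : Fin m → Fin n // StrictMono I}, ‖minorDet (rowsOf y σ) I.1‖ ^ 2 =
      ∏ l, normSqSum (y (σ l)) := by
  have := sum_norm_sq_eq_ofReal fun I : {I : Fin m → Fin n // StrictMono I} =>
    minorDet (rowsOf y σ) I.1
  rw [sum_conj_minorDet_mul, det_rowsOf_self hy hσ] at this
  exact_mod_cast this

theorem sum_conj_contraction_mul [Fintype {I : Fin p → Fin n // StrictMono I}]
    (Y Z : Matrix (Fin (p + 1)) (Fin n) ℂ) (a : Fin n → ℂ) :
    ∑ I : {I : Fin p → Fin n // StrictMono I}, conj (contraction Y a I.1) * contraction Z a I.1 =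
      ∑ s : Fin (p + 1), ∑ t : Fin (p + 1), (-1) ^ (s : ℕ) * (-1) ^ (t : ℕ) *
        (conj (Y s ⬝ᵥ a) * (Z t ⬝ᵥ a)) *
          (Z.submatrix t.succAbove id * (Y.submatrix s.succAbove id)ᴴ).det := by
  simp only [contraction_eq_sum, map_sum, ← sum_conj_minorDet_mul, sum_mul_sum]
  simp only [mul_sum]
  rw [sum_comm]
  refine sum_congr rfl fun s _ => ?_
  rw [sum_comm]
  refine sum_congr rfl fun t _ => sum_congr rfl fun I _ => ?_
  simp only [map_mul, map_pow, map_neg, map_one]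
  ring

/-- The squared norm of the functional `a` on the line spanned by `x`. -/
def lineContact (a x : Fin n → ℂ) : ℝ := ‖x ⬝ᵥ a‖ ^ 2 / normSqSum x

theorem lineContact_nonneg (a x : Fin n → ℂ) : 0 ≤ lineContact a x :=
  div_nonneg (by positivity) (normSqSum_nonneg x)

/-- For x = 0 the quotient in `lineContact` is 0 and both sides vanish, so no nonvanishing
hypothesis is needed. -/
theorem norm_dotProduct_sq_eq (a x : Fin n → ℂ) :
    ‖x ⬝ᵥ a‖ ^ 2 = normSqSum x * lineContact a x := by
  unfold lineContact
  by_cases h : normSqSum x = 0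
  · rw [normSqSum_eq_zero h]; simp [normSqSum]
  · field_simp

theorem rowsOf_submatrix (σ : Fin (p + 1) → ℕ) (s : Fin (p + 1)) :
    (rowsOf y σ).submatrix s.succAbove id = rowsOf y (σ ∘ s.succAbove) := rfl

/-- Only the diagonal s = t of the double sum survives orthogonality. Its Gram determinant lacks the
factor of row s, which ‖y_s · a‖² supplies together with the line contact. -/
theorem sum_norm_sq_contraction (hy : IsOrthogonalSeq y) [Fintype {I : Fin p → Fin n // StrictMono I}]
    {σ : Fin (p + 1) → ℕ} (hσ : Function.Injective σ) (a : Fin n → ℂ) :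
    ∑ I : {I : Fin p → Fin n // StrictMono I}, ‖contraction (rowsOf y σ) a I.1‖ ^ 2 =
      (∏ l, normSqSum (y (σ l))) * ∑ s, lineContact a (y (σ s)) := by
  have := sum_norm_sq_eq_ofReal fun I : {I : Fin p → Fin n // StrictMono I} =>
    contraction (rowsOf y σ) a I.1
  rw [sum_conj_contraction_mul] at this
  have key : ∀ s : Fin (p + 1), ∑ t : Fin (p + 1), (-1) ^ (s : ℕ) * (-1) ^ (t : ℕ) *
        (conj (rowsOf y σ s ⬝ᵥ a) * (rowsOf y σ t ⬝ᵥ a)) *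
          ((rowsOf y σ).submatrix t.succAbove id * ((rowsOf y σ).submatrix s.succAbove id)ᴴ).det =
      (((∏ l, normSqSum (y (σ l))) * lineContact a (y (σ s)) : ℝ) : ℂ) := by
    intro s
    rw [sum_eq_single s]
    · rw [rowsOf_submatrix, det_rowsOf_self hy (hσ.comp Fin.succAbove_right_injective),
        Fin.prod_univ_succAbove _ s]
      have h1 : conj (rowsOf y σ s ⬝ᵥ a) * (rowsOf y σ s ⬝ᵥ a) =
          ((normSqSum (y (σ s)) * lineContact a (y (σ s)) : ℝ) : ℂ) := by
        rw [← norm_dotProduct_sq_eq, mul_comm, Complex.mul_conj, Complex.normSq_eq_norm_sq]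
        rfl
      rw [h1, ← pow_add, ← two_mul, pow_mul]
      simp only [Function.comp]
      push_cast
      ring
    · intro t _ hts
      -- Row t survives the deletion of s but not the deletion of t, and it is orthogonal to all
      -- other rows.
      obtain ⟨j, hj⟩ := Fin.exists_succAbove_eq hts
      rw [rowsOf_submatrix, rowsOf_submatrix, det_rowsOf_eq_zero hy j, mul_zero]
      intro i h
      simp only [Function.comp, hj] at h
      exact Fin.succAbove_ne t i (hσ h)
    · simp
  rw [sum_congr rfl fun s _ => key s, ← Complex.ofReal_sum, ← mul_sum] at this
  exact_mod_cast this

/-- The indices `0, …, p - 1, r`. -/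
def lastReplaced (p r : ℕ) : Fin (p + 1) → ℕ := Fin.snoc (fun l : Fin p => (l : ℕ)) r

theorem lastReplaced_injective {p r : ℕ} (h : p ≤ r) : Function.Injective (lastReplaced p r) := by
  unfold lastReplaced
  rw [Fin.snoc_injective_iff]
  refine ⟨Fin.val_injective, ?_⟩
  rintro ⟨l, hl⟩
  exact absurd l.2 (by simp only at hl; omega)

theorem lastReplaced_self (p : ℕ) : lastReplaced p p = fun l : Fin (p + 1) => (l : ℕ) := by
  ext l
  induction l using Fin.lastCases <;> simp [lastReplaced]

theorem sum_conj_minorDet_lastReplaced (hy : IsOrthogonalSeq y) [Fintype {I : Fin (p + 1) → Fin n // StrictMono I}] :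
    ∑ I : {I : Fin (p + 1) → Fin n // StrictMono I},
      conj (minorDet (rowsOf y (lastReplaced p p)) I.1) *
        minorDet (rowsOf y (lastReplaced p (p + 1))) I.1 = 0 := by
  rw [sum_conj_minorDet_mul, det_rowsOf_eq_zero hy (Fin.last p)]
  intro i
  induction i using Fin.lastCases with
  | last => simp [lastReplaced]
  | cast i => simpa [lastReplaced] using i.2.ne

/-- Only s = t = last contributes. If s is not last, y_p remains on the conjugated side and is
absent from the other; if s is last and t is not, the same holds for row t. -/
theorem sum_conj_contraction_lastReplaced (hy : IsOrthogonalSeq y) [Fintype {I : Fin p → Fin n // StrictMono I}]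
    (a : Fin n → ℂ) :
    ∑ I : {I : Fin p → Fin n // StrictMono I},
      conj (contraction (rowsOf y (lastReplaced p p)) a I.1) *
        contraction (rowsOf y (lastReplaced p (p + 1))) a I.1 =
      conj (y p ⬝ᵥ a) * (y (p + 1) ⬝ᵥ a) * ∏ l ∈ range p, (normSqSum (y l) : ℂ) := by
  rw [sum_conj_contraction_mul, sum_eq_single (Fin.last p), sum_eq_single (Fin.last p)]
  · have h1 : ∀ r, lastReplaced p r ∘ (Fin.last p).succAbove = fun l : Fin p => (l : ℕ) := by
      intro r; ext l; simp [lastReplaced]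
    have h2 : ∀ r, rowsOf y (lastReplaced p r) (Fin.last p) = y r := by
      intro r; simp [lastReplaced]
    rw [rowsOf_submatrix, rowsOf_submatrix, h1, h1, h2, h2, det_rowsOf_self hy Fin.val_injective,
      ← pow_add, ← two_mul, pow_mul, Finset.prod_range]
    simp
  · intro t _ ht
    obtain ⟨j, hj⟩ := Fin.exists_castSucc_eq.2 ht
    rw [rowsOf_submatrix, rowsOf_submatrix, det_rowsOf_eq_zero hy j, mul_zero]
    intro i h
    simp only [Function.comp, Fin.succAbove_last] at h
    rcases Fin.eq_castSucc_or_eq_last (t.succAbove i) with ⟨k, hk⟩ | hk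
    · rw [hk] at h
      simp only [lastReplaced, Fin.snoc_castSucc] at h
      have := Fin.val_injective h
      exact Fin.succAbove_ne t i (by rw [hk, this, hj])
    · rw [hk] at h
      simp only [lastReplaced, Fin.snoc_castSucc, Fin.snoc_last] at h
      exact absurd j.2 (by omega)
  · simp
  · intro s _ hs
    refine sum_eq_zero fun t _ => ?_
    obtain ⟨j, hj⟩ := Fin.exists_succAbove_eq hs.symm
    rw [rowsOf_submatrix, rowsOf_submatrix, det_rowsOf_eq_zero hy j, mul_zero]
    intro i h
    simp only [Function.comp, hj] at h
    have h' : lastReplaced p p (Fin.last p) = p := by simp [lastReplaced]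
    rw [h'] at h
    rcases Fin.eq_castSucc_or_eq_last (t.succAbove i) with ⟨k, hk⟩ | hk
    · rw [hk] at h
      simp only [lastReplaced, Fin.snoc_castSucc] at h
      exact absurd k.2 (by omega)
    · rw [hk] at h
      simp [lastReplaced] at h
  · simp

end Orthogonal

end GaussMap

namespace GaussMap

open Matrix Finset ComplexConjugate

/-! ### Gram–Schmidt frames -/

section GramSchmidt

variable {m n p : ℕ}

/-- Without normalisation a dependent vector simply gives y_l = 0, so the jet need not be
independent and the change of basis stays unitriangular. -/
theorem exists_orthogonal_triangular (x : ℕ → Fin n → ℂ) :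
    ∃ (y : ℕ → Fin n → ℂ) (c : ℕ → ℕ → ℂ), IsOrthogonalSeq y ∧
      ∀ l, x l = y l + ∑ i ∈ range l, c l i • y i := by
  let X : ℕ → EuclideanSpace ℂ (Fin n) := fun l => WithLp.toLp 2 (x l)
  let Y := InnerProductSpace.gramSchmidt ℂ X
  refine ⟨fun l => (Y l).ofLp, fun l i => inner ℂ (Y i) (X l) / (‖Y i‖ : ℂ) ^ 2, ?_, ?_⟩
  · intro i j hij
    have := InnerProductSpace.gramSchmidt_orthogonal ℂ X hij.symm
    rwa [EuclideanSpace.inner_eq_star_dotProduct] at this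
  · intro l
    have := congrArg WithLp.ofLp (InnerProductSpace.gramSchmidt_def'' ℂ X l)
    simpa [X, Y, Nat.Iio_eq_range] using this

theorem sum_Iio_fin {A : Type*} [AddCommMonoid A] (l : Fin m) (f : ℕ → A) :
    ∑ i ∈ Iio l, f i = ∑ i ∈ range l, f i := by
  rw [← Nat.Iio_eq_range, ← Fin.map_valEmbedding_Iio, sum_map]
  rfl

variable {x y : ℕ → Fin n → ℂ} {c : ℕ → ℕ → ℂ}

theorem det_rowsOf_mul_of_triangular (h : ∀ l, x l = y l + ∑ i ∈ range l, c l i • y i)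
    (B : Matrix (Fin n) (Fin (p + 1)) ℂ) :
    (rowsOf x (lastReplaced p p) * B).det = (rowsOf y (lastReplaced p p) * B).det := by
  refine det_mul_of_unitriangular (fun l i => c l i) (fun l => ?_) B
  rw [lastReplaced_self]
  simp only [rowsOf_apply]
  rw [h l, ← sum_Iio_fin l fun i => c l i • y i]

theorem rowsOf_lastReplaced (y : ℕ → Fin n → ℂ) (p r s : ℕ) :
    rowsOf y (lastReplaced p r) = (rowsOf y (lastReplaced p s)).updateRow (Fin.last p) (y r) := by
  ext l k
  induction l using Fin.lastCases with
  | last => simp [lastReplaced]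
  | cast l => simp [lastReplaced]

/-- The components of x_{p+1} along y_0, …, y_{p-1} are removed by the other rows. The component
along y_p stays, because row p is the one that was replaced. -/
theorem det_rowsOf_succ_mul_of_triangular (h : ∀ l, x l = y l + ∑ i ∈ range l, c l i • y i)
    (B : Matrix (Fin n) (Fin (p + 1)) ℂ) :
    (rowsOf x (lastReplaced p (p + 1)) * B).det =
      (rowsOf y (lastReplaced p (p + 1)) * B).det +
        c (p + 1) p * (rowsOf y (lastReplaced p p) * B).det := by
  set A := rowsOf y (lastReplaced p p)
  have h1 : (rowsOf x (lastReplaced p (p + 1)) * B).det =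
      (A.updateRow (Fin.last p) (y (p + 1) + c (p + 1) p • y p) * B).det := by
    refine det_mul_of_unitriangular (fun l i => c (lastReplaced p (p + 1) l) i) (fun l => ?_) B
    have hsum : ∀ f : ℕ → ℂ, ∑ i ∈ Iio l,
        f i • A.updateRow (Fin.last p) (y (p + 1) + c (p + 1) p • y p) i =
        ∑ i ∈ range l, f i • y i := by
      intro f
      rw [← sum_Iio_fin l fun i => f i • y i]
      refine sum_congr rfl fun i hi => ?_
      have hi' : i ≠ Fin.last p := ((mem_Iio.1 hi).trans_le (Fin.le_last l)).ne
      rw [updateRow_ne hi']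
      simp [A, lastReplaced_self]
    rw [hsum]
    induction l using Fin.lastCases with
    | last =>
      simp only [rowsOf_apply, lastReplaced, Fin.snoc_last, updateRow_self, Fin.val_last]
      rw [h (p + 1), sum_range_succ]
      abel
    | cast l =>
      rw [updateRow_ne (Fin.castSucc_lt_last l).ne]
      simp only [rowsOf_apply, lastReplaced, Fin.snoc_castSucc, A, Fin.val_castSucc]
      exact h l
  rw [h1, rowsOf_lastReplaced y p (p + 1) p, updateRow_mul, updateRow_mul, add_vecMul,
    smul_vecMul, det_updateRow_add, det_updateRow_smul, ← updateRow_mul, ← updateRow_mul,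
    ← rowsOf_lastReplaced y p p p]

end GramSchmidt

/-- `∑ |A_I|²`, `∑ |A'_I|²` and `∑ conj A_I A'_I` after adding a multiple of `A` to `A'`. -/
theorem norm_sq_mul_sub_of_add_smul {ι : Type*} [Fintype ι] (A B : ι → ℂ) (β : ℂ) :
    (∑ i, ‖A i‖ ^ 2) * (∑ i, ‖B i + β * A i‖ ^ 2) - ‖∑ i, conj (A i) * (B i + β * A i)‖ ^ 2 =
      (∑ i, ‖A i‖ ^ 2) * (∑ i, ‖B i‖ ^ 2) - ‖∑ i, conj (A i) * B i‖ ^ 2 := by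
  have e : ∀ x : ℂ, ((‖x‖ ^ 2 : ℝ) : ℂ) = conj x * x := fun x => by
    rw [mul_comm, Complex.mul_conj, Complex.normSq_eq_norm_sq]
  have h1 := sum_norm_sq_eq_ofReal A
  have h2 := sum_norm_sq_eq_ofReal B
  have h3 := sum_norm_sq_eq_ofReal fun i => B i + β * A i
  have h4 : ∑ i, conj (A i) * (B i + β * A i) =
      ∑ i, conj (A i) * B i + β * ∑ i, conj (A i) * A i := by
    rw [mul_sum, ← sum_add_distrib]
    exact sum_congr rfl fun i _ => by ring
  have h5 : conj (∑ i, conj (A i) * B i) = ∑ i, conj (B i) * A i := by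
    rw [map_sum]
    exact sum_congr rfl fun i _ => by rw [map_mul, Complex.conj_conj, mul_comm]
  have h6 : ∑ i, conj (B i + β * A i) * (B i + β * A i) = ∑ i, conj (B i) * B i +
      β * ∑ i, conj (B i) * A i + conj β * ∑ i, conj (A i) * B i +
        conj β * β * ∑ i, conj (A i) * A i := by
    simp only [mul_sum, ← sum_add_distrib]
    exact sum_congr rfl fun i _ => by rw [map_add, map_mul]; ring
  apply Complex.ofReal_injective
  rw [Complex.ofReal_sub, Complex.ofReal_sub, Complex.ofReal_mul, Complex.ofReal_mul, h1, h2, h3,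
    e, e, h4, h6, map_add, map_mul, h5, ← h1, Complex.conj_ofReal]
  ring

end GaussMap

namespace GaussMap

open Matrix Finset ComplexConjugate

/-! ### Closed formulas in the frame -/

section FrameFormulas

variable {n p : ℕ} {x y : ℕ → Fin n → ℂ} {c : ℕ → ℕ → ℂ}

theorem prod_lastReplaced (f : ℕ → ℝ) (p r : ℕ) :
    ∏ l, f (lastReplaced p r l) = (∏ l ∈ range p, f l) * f r := by
  rw [Fin.prod_univ_castSucc, Finset.prod_range]
  simp [lastReplaced]

theorem sum_lastReplaced (f : ℕ → ℝ) (p r : ℕ) :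
    ∑ l, f (lastReplaced p r l) = (∑ l ∈ range p, f l) + f r := by
  rw [Fin.sum_univ_castSucc, Finset.sum_range]
  simp [lastReplaced]

theorem minorDet_succ_frame (h : ∀ l, x l = y l + ∑ i ∈ range l, c l i • y i)
    (I : Fin (p + 1) → Fin n) :
    minorDet (rowsOf x (lastReplaced p (p + 1))) I =
      minorDet (rowsOf y (lastReplaced p (p + 1))) I +
        c (p + 1) p * minorDet (rowsOf x (lastReplaced p p)) I := by
  simp only [minorDet_eq_det_mul, det_rowsOf_mul_of_triangular h,
    det_rowsOf_succ_mul_of_triangular h]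

theorem contraction_succ_frame (h : ∀ l, x l = y l + ∑ i ∈ range l, c l i • y i)
    (a : Fin n → ℂ) (I : Fin p → Fin n) :
    contraction (rowsOf x (lastReplaced p (p + 1))) a I =
      contraction (rowsOf y (lastReplaced p (p + 1))) a I +
        c (p + 1) p * contraction (rowsOf x (lastReplaced p p)) a I := by
  simp only [contraction, det_rowsOf_mul_of_triangular h, det_rowsOf_succ_mul_of_triangular h]

section Derived

variable [Fintype {I : Fin (p + 1) → Fin n // StrictMono I}]

theorem sum_norm_sq_minorDet_frame (hy : IsOrthogonalSeq y)
    (h : ∀ l, x l = y l + ∑ i ∈ range l, c l i • y i) :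
    ∑ I : {I : Fin (p + 1) → Fin n // StrictMono I},
      ‖minorDet (rowsOf x (lastReplaced p p)) I.1‖ ^ 2 = ∏ l ∈ range (p + 1), normSqSum (y l) := by
  simp only [minorDet_eq_det_mul, det_rowsOf_mul_of_triangular h]
  simp only [← minorDet_eq_det_mul]
  rw [sum_norm_sq_minorDet hy (lastReplaced_injective le_rfl),
    prod_lastReplaced fun l => normSqSum (y l), prod_range_succ]

theorem sum_conj_minorDet_frame (hy : IsOrthogonalSeq y)
    (h : ∀ l, x l = y l + ∑ i ∈ range l, c l i • y i) :
    ∑ I : {I : Fin (p + 1) → Fin n // StrictMono I},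
      conj (minorDet (rowsOf x (lastReplaced p p)) I.1) *
        minorDet (rowsOf y (lastReplaced p (p + 1))) I.1 = 0 := by
  simp only [minorDet_eq_det_mul, det_rowsOf_mul_of_triangular h]
  simp only [← minorDet_eq_det_mul]
  exact sum_conj_minorDet_lastReplaced hy

/-- The left side is the numerator of ∂∂̄ log ∑|A_I|² when the second family is the derivative A'.
It does not change when a multiple of A is subtracted from A', and in the frame this makes A'
orthogonal to A. -/
theorem minorDet_lagrange_frame (hy : IsOrthogonalSeq y)
    (h : ∀ l, x l = y l + ∑ i ∈ range l, c l i • y i) :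
    (∑ I : {I : Fin (p + 1) → Fin n // StrictMono I},
        ‖minorDet (rowsOf x (lastReplaced p p)) I.1‖ ^ 2) *
      (∑ I : {I : Fin (p + 1) → Fin n // StrictMono I},
        ‖minorDet (rowsOf x (lastReplaced p (p + 1))) I.1‖ ^ 2) -
      ‖∑ I : {I : Fin (p + 1) → Fin n // StrictMono I},
        conj (minorDet (rowsOf x (lastReplaced p p)) I.1) *
          minorDet (rowsOf x (lastReplaced p (p + 1))) I.1‖ ^ 2 =
      (∏ l ∈ range (p + 1), normSqSum (y l)) *
        ((∏ l ∈ range p, normSqSum (y l)) * normSqSum (y (p + 1))) := by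
  simp only [minorDet_succ_frame h]
  rw [norm_sq_mul_sub_of_add_smul, sum_conj_minorDet_frame hy h, sum_norm_sq_minorDet_frame hy h,
    sum_norm_sq_minorDet hy (lastReplaced_injective p.le_succ),
    prod_lastReplaced fun l => normSqSum (y l)]
  simp

end Derived

section Contact

variable [Fintype {I : Fin p → Fin n // StrictMono I}]

theorem sum_norm_sq_contraction_frame (hy : IsOrthogonalSeq y)
    (h : ∀ l, x l = y l + ∑ i ∈ range l, c l i • y i) (a : Fin n → ℂ) :
    ∑ I : {I : Fin p → Fin n // StrictMono I},
      ‖contraction (rowsOf x (lastReplaced p p)) a I.1‖ ^ 2 =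
        (∏ l ∈ range (p + 1), normSqSum (y l)) * ∑ l ∈ range (p + 1), lineContact a (y l) := by
  simp only [contraction, det_rowsOf_mul_of_triangular h]
  have := sum_norm_sq_contraction hy (lastReplaced_injective (le_refl p)) a
  rw [prod_lastReplaced fun l => normSqSum (y l), ← prod_range_succ,
    sum_lastReplaced fun l => lineContact a (y l), ← sum_range_succ] at this
  exact this

theorem norm_sum_conj_contraction_frame (hy : IsOrthogonalSeq y)
    (h : ∀ l, x l = y l + ∑ i ∈ range l, c l i • y i) (a : Fin n → ℂ) :
    ‖∑ I : {I : Fin p → Fin n // StrictMono I},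
      conj (contraction (rowsOf x (lastReplaced p p)) a I.1) *
        contraction (rowsOf y (lastReplaced p (p + 1))) a I.1‖ ^ 2 =
      (∏ l ∈ range p, normSqSum (y l)) ^ 2 * (normSqSum (y p) * lineContact a (y p)) *
        (normSqSum (y (p + 1)) * lineContact a (y (p + 1))) := by
  have := sum_conj_contraction_lastReplaced (p := p) hy a
  simp only [contraction] at this ⊢
  simp only [det_rowsOf_mul_of_triangular h]
  rw [this, ← norm_dotProduct_sq_eq, ← norm_dotProduct_sq_eq, norm_mul, norm_mul, RCLike.norm_conj,
    ← Complex.ofReal_prod, Complex.norm_real, mul_pow, Real.norm_eq_abs, sq_abs]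
  ring

/-- With Θ_m = ∑_{l<m} τ_l, the point is the identity (Θ_p + τ_p)(Θ_p + τ_{p+1}) - τ_p τ_{p+1} = Θ_p
Θ_{p+2}. -/
theorem contraction_lagrange_frame (hy : IsOrthogonalSeq y)
    (h : ∀ l, x l = y l + ∑ i ∈ range l, c l i • y i) (a : Fin n → ℂ) :
    (∑ I : {I : Fin p → Fin n // StrictMono I},
        ‖contraction (rowsOf x (lastReplaced p p)) a I.1‖ ^ 2) *
      (∑ I : {I : Fin p → Fin n // StrictMono I},
        ‖contraction (rowsOf x (lastReplaced p (p + 1))) a I.1‖ ^ 2) -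
      ‖∑ I : {I : Fin p → Fin n // StrictMono I},
        conj (contraction (rowsOf x (lastReplaced p p)) a I.1) *
          contraction (rowsOf x (lastReplaced p (p + 1))) a I.1‖ ^ 2 =
      (∏ l ∈ range p, normSqSum (y l)) ^ 2 * normSqSum (y p) * normSqSum (y (p + 1)) *
        ((∑ l ∈ range p, lineContact a (y l)) * ∑ l ∈ range (p + 2), lineContact a (y l)) := by
  simp only [contraction_succ_frame h]
  rw [norm_sq_mul_sub_of_add_smul, norm_sum_conj_contraction_frame hy h,
    sum_norm_sq_contraction_frame hy h, sum_norm_sq_contraction hy (lastReplaced_injective p.le_succ),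
    prod_lastReplaced fun l => normSqSum (y l), sum_lastReplaced fun l => lineContact a (y l),
    sum_range_succ _ (p + 1), sum_range_succ _ p, prod_range_succ]
  ring

end Contact

/-- For the jet this is |∂ log φ_p²|². The coefficient c_{p+1,p} shifts both logarithmic derivatives
equally and cancels in the difference. -/
theorem log_deriv_difference_frame [Fintype {I : Fin p → Fin n // StrictMono I}]
    [Fintype {I : Fin (p + 1) → Fin n // StrictMono I}] (hy : IsOrthogonalSeq y)
    (h : ∀ l, x l = y l + ∑ i ∈ range l, c l i • y i) (a : Fin n → ℂ)
    (h0 : ∀ l ≤ p, normSqSum (y l) ≠ 0) (hc : ∑ l ∈ range (p + 1), lineContact a (y l) ≠ 0) :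
    ‖(∑ I : {I : Fin p → Fin n // StrictMono I},
        conj (contraction (rowsOf x (lastReplaced p p)) a I.1) *
          contraction (rowsOf x (lastReplaced p (p + 1))) a I.1) /
        ((∑ I : {I : Fin p → Fin n // StrictMono I},
          ‖contraction (rowsOf x (lastReplaced p p)) a I.1‖ ^ 2 : ℝ) : ℂ) -
      (∑ I : {I : Fin (p + 1) → Fin n // StrictMono I},
        conj (minorDet (rowsOf x (lastReplaced p p)) I.1) *
          minorDet (rowsOf x (lastReplaced p (p + 1))) I.1) /
        ((∑ I : {I : Fin (p + 1) → Fin n // StrictMono I},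
          ‖minorDet (rowsOf x (lastReplaced p p)) I.1‖ ^ 2 : ℝ) : ℂ)‖ ^ 2 =
      normSqSum (y (p + 1)) / normSqSum (y p) * (lineContact a (y p) * lineContact a (y (p + 1))) /
        (∑ l ∈ range (p + 1), lineContact a (y l)) ^ 2 := by
  have hP : ∏ l ∈ range (p + 1), normSqSum (y l) ≠ 0 :=
    prod_ne_zero_iff.2 fun l hl => h0 l (by simpa [Nat.lt_succ_iff] using hl)
  have hp : normSqSum (y p) ≠ 0 := h0 p le_rfl
  have hP' : ∏ l ∈ range p, normSqSum (y l) ≠ 0 := by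
    rw [prod_range_succ] at hP; exact left_ne_zero_of_mul hP
  have expand : ∀ {ι : Type} [Fintype ι] (A B : ι → ℂ) (β : ℂ), (∑ i, ‖A i‖ ^ 2) ≠ 0 →
      (∑ i, conj (A i) * (B i + β * A i)) / ((∑ i, ‖A i‖ ^ 2 : ℝ) : ℂ) =
        (∑ i, conj (A i) * B i) / ((∑ i, ‖A i‖ ^ 2 : ℝ) : ℂ) + β := by
    intro ι _ A B β hA
    have : ∑ i, conj (A i) * (B i + β * A i) =
        ∑ i, conj (A i) * B i + β * ((∑ i, ‖A i‖ ^ 2 : ℝ) : ℂ) := by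
      rw [sum_norm_sq_eq_ofReal, mul_sum, ← sum_add_distrib]
      exact sum_congr rfl fun i _ => by ring
    rw [this, add_div, mul_div_cancel_right₀ _ (by exact_mod_cast hA)]
  simp only [contraction_succ_frame h, minorDet_succ_frame h]
  rw [expand, expand, sum_conj_minorDet_frame hy h, sum_norm_sq_contraction_frame hy h, zero_div,
    zero_add, add_sub_cancel_right, norm_div, div_pow, norm_sum_conj_contraction_frame hy h,
    Complex.norm_real, Real.norm_eq_abs, sq_abs, prod_range_succ]
  · field_simp
  · rw [sum_norm_sq_minorDet_frame hy h]; exact hP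
  · rw [sum_norm_sq_contraction_frame hy h]; exact mul_ne_zero hP hc

end FrameFormulas

end GaussMap

/-! ### Calculus of ∂ and ∂∂̄ in one complex variable -/

namespace GaussMap

open Finset ComplexConjugate Filter Topology

/-- `u` is of class `C²` at `z`, with `∂u/∂z = G` and `∂²u/∂z∂z̄ = L` there. -/
structure HasLeviData (u : ℂ → ℝ) (z : ℂ) (G : ℂ) (L : ℝ) : Prop where
  contDiffAt : ContDiffAt ℝ 2 u z
  fderiv_apply : ∀ v, fderiv ℝ u z v = 2 * (G * v).re
  laplacian_eq : Laplacian.laplacian u z = 4 * L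

namespace HasLeviData

variable {u w : ℂ → ℝ} {z G H : ℂ} {L K : ℝ}

theorem differentiableAt (h : HasLeviData u z G L) : DifferentiableAt ℝ u z :=
  h.contDiffAt.differentiableAt (by norm_num)

theorem congr (h : HasLeviData u z G L) (he : w =ᶠ[𝓝 z] u) : HasLeviData w z G L where
  contDiffAt := h.contDiffAt.congr_of_eventuallyEq he
  fderiv_apply v := by rw [he.fderiv_eq, h.fderiv_apply]
  laplacian_eq := by
    rw [(InnerProductSpace.laplacian_congr_nhds he).self_of_nhds, h.laplacian_eq]

theorem const (c : ℝ) (z : ℂ) : HasLeviData (fun _ => c) z 0 0 where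
  contDiffAt := contDiffAt_const
  fderiv_apply v := by simp
  laplacian_eq := by rw [InnerProductSpace.laplacian_const]; simp

theorem add (h : HasLeviData u z G L) (k : HasLeviData w z H K) :
    HasLeviData (fun x => u x + w x) z (G + H) (L + K) where
  contDiffAt := h.contDiffAt.add k.contDiffAt
  fderiv_apply v := by
    rw [fderiv_fun_add h.differentiableAt k.differentiableAt]
    simp only [add_apply, h.fderiv_apply, k.fderiv_apply, add_mul,
      Complex.add_re, mul_add]
  laplacian_eq := by
    have := h.contDiffAt.laplacian_add k.contDiffAt
    rw [show (fun x => u x + w x) = u + w from rfl, this, h.laplacian_eq, k.laplacian_eq, mul_add]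

theorem const_mul (c : ℝ) (h : HasLeviData u z G L) :
    HasLeviData (fun x => c * u x) z (c * G) (c * L) where
  contDiffAt := contDiffAt_const.mul h.contDiffAt
  fderiv_apply v := by
    rw [fderiv_const_mul h.differentiableAt]
    simp only [smul_apply, h.fderiv_apply, smul_eq_mul, mul_assoc,
      Complex.re_ofReal_mul]
    ring
  laplacian_eq := by
    have := InnerProductSpace.laplacian_smul c h.contDiffAt
    rw [show (fun x => c * u x) = c • u from rfl, this, h.laplacian_eq, smul_eq_mul]
    ring

theorem sum {ι : Type*} (s : Finset ι) {u : ι → ℂ → ℝ} {G : ι → ℂ} {L : ι → ℝ}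
    (h : ∀ i ∈ s, HasLeviData (u i) z (G i) (L i)) :
    HasLeviData (fun x => ∑ i ∈ s, u i x) z (∑ i ∈ s, G i) (∑ i ∈ s, L i) := by
  classical
  induction s using Finset.induction_on with
  | empty => simpa using const 0 z
  | insert i s hi ih =>
    simp only [sum_insert hi]
    exact (h i (mem_insert_self _ _)).add (ih fun j hj => h j (mem_insert_of_mem hj))

theorem norm_sq_eq (G : ℂ) : (2 * (G * 1).re) ^ 2 + (2 * (G * Complex.I).re) ^ 2 = 4 * ‖G‖ ^ 2 := by
  rw [Complex.sq_norm, Complex.normSq_apply]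
  simp
  ring

theorem log (h : HasLeviData u z G L) (hu : u z ≠ 0) :
    HasLeviData (fun x => Real.log (u x)) z (G / u z) (L / u z - ‖G‖ ^ 2 / u z ^ 2) := by
  have hev : (fderiv ℝ fun x => Real.log (u x)) =ᶠ[𝓝 z] fun x => (u x)⁻¹ • fderiv ℝ u x := by
    filter_upwards [h.contDiffAt.eventually (by simp), h.contDiffAt.continuousAt.eventually_ne hu]
      with x hx hx'
    exact fderiv.log (hx.differentiableAt (by norm_num)) hx'
  refine ⟨h.contDiffAt.log hu, fun v => ?_, ?_⟩
  · rw [hev.self_of_nhds]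
    simp only [smul_apply, h.fderiv_apply, smul_eq_mul]
    rw [div_mul_eq_mul_div, Complex.div_ofReal_re]
    field_simp
  · have hd : DifferentiableAt ℝ (fderiv ℝ u) z :=
      (h.contDiffAt.fderiv_right (m := 1) (by norm_num)).differentiableAt (by norm_num)
    have hi : DifferentiableAt ℝ (fun x => (u x)⁻¹) z := h.differentiableAt.inv hu
    -- The Laplacian only needs second derivatives along the diagonal, in the directions 1 and i.
    have key : ∀ v, fderiv ℝ (fderiv ℝ fun x => Real.log (u x)) z v v =
        (u z)⁻¹ * fderiv ℝ (fderiv ℝ u) z v v - (2 * (G * v).re) ^ 2 / u z ^ 2 := by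
      intro v
      have hinv := (hasDerivAt_inv hu).comp_hasFDerivAt z h.differentiableAt.hasFDerivAt
      rw [Function.comp_def] at hinv
      rw [hev.fderiv_eq, fderiv_fun_smul hi hd, hinv.fderiv]
      simp [h.fderiv_apply]
      field_simp
      ring
    have hL := h.laplacian_eq
    rw [InnerProductSpace.laplacian_eq_iteratedFDeriv_complexPlane] at hL ⊢
    simp only [iteratedFDeriv_two_apply, Matrix.cons_val_zero, Matrix.cons_val_one] at hL ⊢
    rw [key, key]
    have := norm_sq_eq G
    have e : ∀ A B P Q U : ℝ, U ≠ 0 → A + B = 4 * L → P + Q = 4 * ‖G‖ ^ 2 →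
        U⁻¹ * A - P / U ^ 2 + (U⁻¹ * B - Q / U ^ 2) = 4 * (L / U - ‖G‖ ^ 2 / U ^ 2) := by
      intro A B P Q U hU h1 h2
      field_simp
      linear_combination U * h1 - h2
    exact e _ _ _ _ _ hu hL this

theorem hasFDerivAt_real {f : ℂ → ℂ} {f' : ℂ} (h : HasDerivAt f f' z) :
    HasFDerivAt f (f' • (ContinuousLinearMap.id ℝ ℂ)) z := by
  refine (h.hasFDerivAt.restrictScalars ℝ).congr_fderiv ?_
  ext v
  simp [mul_comm]

theorem norm_sq {f : ℂ → ℂ} (hf : AnalyticAt ℂ f z) :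
    HasLeviData (fun x => ‖f x‖ ^ 2) z (conj (f z) * deriv f z) (‖deriv f z‖ ^ 2) := by
  have hev : (fderiv ℝ fun x => ‖f x‖ ^ 2) =ᶠ[𝓝 z] fun x =>
      (2 : ℝ) • Complex.reCLM.comp
        ((conj (f x) * deriv f x) • (ContinuousLinearMap.id ℝ ℂ)) := by
    filter_upwards [hf.eventually_analyticAt] with x hx
    have h1 : HasFDerivAt f ((deriv f x) • (ContinuousLinearMap.id ℝ ℂ)) x :=
      hasFDerivAt_real hx.differentiableAt.hasDerivAt
    rw [(h1.norm_sq).fderiv]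
    ext
    simp [Complex.inner]
    ring
  have hd : DifferentiableAt ℂ (deriv f) z := hf.deriv.differentiableAt
  have h1 : HasFDerivAt f ((deriv f z) • (ContinuousLinearMap.id ℝ ℂ)) z :=
    hasFDerivAt_real hf.differentiableAt.hasDerivAt
  have h2 : HasFDerivAt (deriv f) ((deriv (deriv f) z) • (ContinuousLinearMap.id ℝ ℂ)) z :=
    hasFDerivAt_real hd.hasDerivAt
  refine ⟨?_, fun v => ?_, ?_⟩
  · exact (hf.contDiffAt.restrict_scalars ℝ).norm_sq ℂ
  · rw [hev.self_of_nhds]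
    simp
  · have hcm : HasFDerivAt (fun x => conj (f x) * deriv f x) _ z :=
      (Complex.conjCLE.toContinuousLinearMap.hasFDerivAt.comp z h1).mul h2
    -- The term with f'' is quadratic in v and cancels between v = 1 and v = i, leaving 4|f'|².
    have key : ∀ v, fderiv ℝ (fderiv ℝ fun x => ‖f x‖ ^ 2) z v v =
        2 * ((conj (f z) * (deriv (deriv f) z * v) + deriv f z * conj (deriv f z * v)) * v).re := by
      intro v
      let Φ : ℂ →L[ℝ] (ℂ →L[ℝ] ℝ) :=
        (2 : ℝ) • (ContinuousLinearMap.compL ℝ ℂ ℂ ℝ Complex.reCLM).comp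
          (ContinuousLinearMap.mul ℝ ℂ)
      have hΦ : (fun x => (2 : ℝ) • Complex.reCLM.comp
          ((conj (f x) * deriv f x) • (ContinuousLinearMap.id ℝ ℂ))) =
          fun x => Φ (conj (f x) * deriv f x) := by
        ext x
        simp [Φ]
      have hc := Φ.hasFDerivAt.comp z hcm
      rw [Function.comp_def] at hc
      rw [hev.fderiv_eq, hΦ, hc.fderiv]
      simp [Φ]
      ring
    rw [InnerProductSpace.laplacian_eq_iteratedFDeriv_complexPlane]
    simp only [iteratedFDeriv_two_apply, Matrix.cons_val_zero, Matrix.cons_val_one]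
    rw [key, key, Complex.sq_norm, Complex.normSq_apply]
    simp
    ring

end HasLeviData

end GaussMap

namespace GaussMap

open Matrix Finset ComplexConjugate Filter Topology

/-! ### Derivatives of determinants of jets -/

section DetDerivative

variable {m : ℕ} {z : ℂ}

theorem hasDerivAt_det {N : ℂ → Matrix (Fin m) (Fin m) ℂ} {N' : Matrix (Fin m) (Fin m) ℂ}
    (h : ∀ i j, HasDerivAt (fun w => N w i j) (N' i j) z) :
    HasDerivAt (fun w => (N w).det) (∑ l, ((N z).updateRow l (N' l)).det) z := by
  have key : ∑ l, ((N z).updateRow l (N' l)).det = ∑ σ : Equiv.Perm (Fin m),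
      ((Equiv.Perm.sign σ : ℤ) : ℂ) *
        ∑ i, (∏ j ∈ univ.erase i, N z (σ j) j) • N' (σ i) i := by
    simp only [det_apply']
    rw [sum_comm]
    refine sum_congr rfl fun σ _ => ?_
    rw [← Equiv.sum_comp σ, mul_sum]
    refine sum_congr rfl fun i _ => ?_
    rw [← mul_prod_erase univ _ (mem_univ i), updateRow_self, smul_eq_mul,
      mul_comm (∏ j ∈ univ.erase i, N z (σ j) j)]
    congr 2
    refine prod_congr rfl fun j hj => ?_
    rw [updateRow_ne (σ.injective.ne (ne_of_mem_erase hj))]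
  rw [key]
  simp only [det_apply']
  refine HasDerivAt.fun_sum fun σ _ => HasDerivAt.const_mul _ ?_
  exact HasDerivAt.fun_finsetProd fun i _ => h (σ i) i

theorem analyticAt_det {N : ℂ → Matrix (Fin m) (Fin m) ℂ}
    (h : ∀ i j, AnalyticAt ℂ (fun w => N w i j) z) : AnalyticAt ℂ (fun w => (N w).det) z := by
  simp only [det_apply']
  refine Finset.analyticAt_fun_sum _ fun σ _ => analyticAt_const.mul ?_
  exact Finset.analyticAt_fun_prod _ fun i _ => h (σ i) i

end DetDerivative

section Jets

variable {M p : ℕ}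

/-- The derivatives `g^{(l)}(z)`. -/
def jet (g : Fin (M + 1) → ℂ → ℂ) (z : ℂ) (l : ℕ) : Fin (M + 1) → ℂ := fun k =>
  iteratedDeriv l (g k) z

theorem minorDet_jet (g : Fin (M + 1) → ℂ → ℂ) (z : ℂ) (I : Fin (p + 1) → Fin (M + 1)) :
    minorDet (rowsOf (jet g z) (lastReplaced p p)) I = wronskianAt (fun j => g (I j)) z := by
  rw [lastReplaced_self]
  rfl

theorem contraction_jet (g : Fin (M + 1) → ℂ → ℂ) (a : Fin (M + 1) → ℂ) (z : ℂ)
    (I : Fin p → Fin (M + 1)) :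
    contraction (rowsOf (jet g z) (lastReplaced p p)) a I =
      ∑ l, a l * wronskianAt (Fin.cons (g l) fun r => g (I r)) z := by
  rw [contraction_eq_sum, lastReplaced_self]
  simp only [wronskianAt, det_succ_column_zero, mul_sum, dotProduct, sum_mul]
  rw [sum_comm]
  refine sum_congr rfl fun l _ => sum_congr rfl fun s _ => ?_
  have : minorDet ((rowsOf (jet g z) fun l : Fin (p + 1) => (l : ℕ)).submatrix s.succAbove id) I =
      ((of fun (i j : Fin (p + 1)) => iteratedDeriv (i : ℕ)
        ((Fin.cons (g l) fun r => g (I r) : Fin (p + 1) → ℂ → ℂ) j) z).submatrix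
          s.succAbove Fin.succ).det := by
    unfold minorDet
    congr 1
  rw [this]
  simp [jet]
  ring

theorem derivedNorm_sq (g : Fin (M + 1) → ℂ → ℂ) (z : ℂ)
    [Fintype {I : Fin (p + 1) → Fin (M + 1) // StrictMono I}] :
    derivedNorm g p z ^ 2 = ∑ I : {I : Fin (p + 1) → Fin (M + 1) // StrictMono I},
      ‖minorDet (rowsOf (jet g z) (lastReplaced p p)) I.1‖ ^ 2 := by
  unfold derivedNorm
  rw [Real.sq_sqrt (sum_nonneg fun _ _ => by positivity)]
  simp only [minorDet_jet]
  convert rfl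

theorem contactNorm_sq (g : Fin (M + 1) → ℂ → ℂ) (a : Fin (M + 1) → ℂ) (z : ℂ)
    [Fintype {I : Fin p → Fin (M + 1) // StrictMono I}] :
    contactNorm g a p z ^ 2 = ∑ I : {I : Fin p → Fin (M + 1) // StrictMono I},
      ‖contraction (rowsOf (jet g z) (lastReplaced p p)) a I.1‖ ^ 2 := by
  unfold contactNorm
  rw [Real.sq_sqrt (sum_nonneg fun _ _ => by positivity)]
  simp only [contraction_jet]
  convert rfl

theorem derivedNorm_nonneg (g : Fin (M + 1) → ℂ → ℂ) (z : ℂ) : 0 ≤ derivedNorm g p z :=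
  Real.sqrt_nonneg _

theorem contactNorm_nonneg (g : Fin (M + 1) → ℂ → ℂ) (a : Fin (M + 1) → ℂ) (z : ℂ) :
    0 ≤ contactNorm g a p z :=
  Real.sqrt_nonneg _

variable {g : Fin (M + 1) → ℂ → ℂ} {z : ℂ}

theorem analyticAt_jet (hg : ∀ k, AnalyticAt ℂ (g k) z) (l : ℕ) (k : Fin (M + 1)) :
    AnalyticAt ℂ (fun w => jet g w l k) z := by
  simp only [jet, iteratedDeriv_eq_iterate]
  exact (hg k).iterated_deriv l

theorem hasDerivAt_jet (hg : ∀ k, AnalyticAt ℂ (g k) z) (l : ℕ) (k : Fin (M + 1)) :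
    HasDerivAt (fun w => jet g w l k) (jet g z (l + 1) k) z := by
  have := (analyticAt_jet hg l k).differentiableAt.hasDerivAt
  unfold jet at this ⊢
  rwa [iteratedDeriv_succ]

theorem analyticAt_det_jet_mul (hg : ∀ k, AnalyticAt ℂ (g k) z) (σ : Fin (p + 1) → ℕ)
    (B : Matrix (Fin (M + 1)) (Fin (p + 1)) ℂ) :
    AnalyticAt ℂ (fun w => (rowsOf (jet g w) σ * B).det) z := by
  refine analyticAt_det fun i j => ?_
  simp only [mul_apply, rowsOf_apply]
  exact Finset.analyticAt_fun_sum _ fun k _ => (analyticAt_jet hg _ k).mul analyticAt_const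

/-- Differentiating a row l < p makes it equal to row l+1, so only the last row contributes. -/
theorem deriv_det_jet_mul (hg : ∀ k, AnalyticAt ℂ (g k) z)
    (B : Matrix (Fin (M + 1)) (Fin (p + 1)) ℂ) :
    deriv (fun w => (rowsOf (jet g w) (lastReplaced p p) * B).det) z =
      (rowsOf (jet g z) (lastReplaced p (p + 1)) * B).det := by
  have h := hasDerivAt_det (z := z) (N := fun w => rowsOf (jet g w) (lastReplaced p p) * B)
    (N' := (rowsOf (jet g z) fun l : Fin (p + 1) => (l : ℕ) + 1) * B) (fun i j => by
      simp only [mul_apply, lastReplaced_self, rowsOf_apply]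
      exact HasDerivAt.fun_sum fun k _ => (hasDerivAt_jet hg _ k).mul_const _)
  rw [h.deriv, sum_eq_single (Fin.last p)]
  · rw [rowsOf_lastReplaced (jet g z) p (p + 1) p, updateRow_mul]
    congr 2
  · intro l _ hl
    obtain ⟨i, rfl⟩ := Fin.exists_castSucc_eq.2 hl
    refine det_zero_of_row_eq (Fin.castSucc_lt_succ (i := i)).ne ?_
    rw [updateRow_self, updateRow_ne (Fin.castSucc_lt_succ (i := i)).ne']
    ext j
    simp [mul_apply, lastReplaced_self]
  · simp

theorem analyticAt_minorDet_jet (hg : ∀ k, AnalyticAt ℂ (g k) z) (I : Fin (p + 1) → Fin (M + 1)) :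
    AnalyticAt ℂ (fun w => minorDet (rowsOf (jet g w) (lastReplaced p p)) I) z := by
  simp only [minorDet_eq_det_mul]
  exact analyticAt_det_jet_mul hg _ _

theorem deriv_minorDet_jet (hg : ∀ k, AnalyticAt ℂ (g k) z) (I : Fin (p + 1) → Fin (M + 1)) :
    deriv (fun w => minorDet (rowsOf (jet g w) (lastReplaced p p)) I) z =
      minorDet (rowsOf (jet g z) (lastReplaced p (p + 1))) I := by
  simp only [minorDet_eq_det_mul]
  exact deriv_det_jet_mul hg _

end Jets

/-! ### Levi forms of log|F_p|² and -2 log log(δ/φ_p) -/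

section LeviData

/-- The gradient is needed only for composing with the logarithm; `ddc` depends on the Laplacian
alone, so at the end it is forgotten. -/
theorem HasLeviData.exists_of_eq {u : ℂ → ℝ} {z G : ℂ} {L L' : ℝ} (h : HasLeviData u z G L)
    (e : L = L') : ∃ G, HasLeviData u z G L' :=
  ⟨G, e ▸ h⟩

theorem div_sub_div_same_sq {P : ℝ} (hP : P ≠ 0) (L G : ℝ) :
    (P * L - G) / P ^ 2 = L / P - G / P ^ 2 := by
  field_simp

variable {M p : ℕ} {g : Fin (M + 1) → ℂ → ℂ} {z : ℂ} {y : ℕ → Fin (M + 1) → ℂ} {c : ℕ → ℕ → ℂ}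

open Classical in
theorem hasLeviData_derivedNorm_sq (hg : ∀ k, AnalyticAt ℂ (g k) z) :
    HasLeviData (fun w => derivedNorm g p w ^ 2) z
      (∑ I : {I : Fin (p + 1) → Fin (M + 1) // StrictMono I},
        conj (minorDet (rowsOf (jet g z) (lastReplaced p p)) I.1) *
          minorDet (rowsOf (jet g z) (lastReplaced p (p + 1))) I.1)
      (∑ I : {I : Fin (p + 1) → Fin (M + 1) // StrictMono I},
        ‖minorDet (rowsOf (jet g z) (lastReplaced p (p + 1))) I.1‖ ^ 2) := by
  simp only [derivedNorm_sq, ← deriv_minorDet_jet hg]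
  exact HasLeviData.sum _ fun I _ => HasLeviData.norm_sq (analyticAt_minorDet_jet hg I.1)

open Classical in
theorem hasLeviData_contactNorm_sq (hg : ∀ k, AnalyticAt ℂ (g k) z) (a : Fin (M + 1) → ℂ) :
    HasLeviData (fun w => contactNorm g a p w ^ 2) z
      (∑ I : {I : Fin p → Fin (M + 1) // StrictMono I},
        conj (contraction (rowsOf (jet g z) (lastReplaced p p)) a I.1) *
          contraction (rowsOf (jet g z) (lastReplaced p (p + 1))) a I.1)
      (∑ I : {I : Fin p → Fin (M + 1) // StrictMono I},
        ‖contraction (rowsOf (jet g z) (lastReplaced p (p + 1))) a I.1‖ ^ 2) := by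
  simp only [contactNorm_sq]
  refine HasLeviData.sum _ fun I _ => ?_
  have h1 := analyticAt_det_jet_mul hg (lastReplaced p p) (contactCols a I.1)
  have h2 := HasLeviData.norm_sq h1
  rw [deriv_det_jet_mul hg] at h2
  exact h2

theorem derivedNorm_sq_frame (hy : IsOrthogonalSeq y)
    (h : ∀ l, jet g z l = y l + ∑ i ∈ range l, c l i • y i) :
    derivedNorm g p z ^ 2 = ∏ l ∈ range (p + 1), normSqSum (y l) := by
  classical
  rw [derivedNorm_sq, sum_norm_sq_minorDet_frame hy h]

theorem contactNorm_sq_frame (hy : IsOrthogonalSeq y)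
    (h : ∀ l, jet g z l = y l + ∑ i ∈ range l, c l i • y i) (a : Fin (M + 1) → ℂ) :
    contactNorm g a p z ^ 2 =
      (∏ l ∈ range (p + 1), normSqSum (y l)) * ∑ l ∈ range (p + 1), lineContact a (y l) := by
  classical
  rw [contactNorm_sq, sum_norm_sq_contraction_frame hy h]

/-- The Levi form of `log |F_p|²`. -/
theorem exists_hasLeviData_log_derivedNorm_sq (hg : ∀ k, AnalyticAt ℂ (g k) z)
    (hy : IsOrthogonalSeq y) (h : ∀ l, jet g z l = y l + ∑ i ∈ range l, c l i • y i)
    (h0 : ∀ l ≤ p, normSqSum (y l) ≠ 0) :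
    ∃ G, HasLeviData (fun w => Real.log (derivedNorm g p w ^ 2)) z G
      (normSqSum (y (p + 1)) / normSqSum (y p)) := by
  classical
  have hP : ∏ l ∈ range (p + 1), normSqSum (y l) ≠ 0 :=
    prod_ne_zero_iff.2 fun l hl => h0 l (by simpa [Nat.lt_succ_iff] using hl)
  have h1 := (hasLeviData_derivedNorm_sq (p := p) hg).log
    (by rw [derivedNorm_sq_frame hy h]; exact hP)
  have h2 := minorDet_lagrange_frame (p := p) hy h
  refine h1.exists_of_eq ?_
  rw [sum_norm_sq_minorDet_frame hy h] at h2
  rw [derivedNorm_sq_frame hy h]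
  have e : ∀ P P' T U L G : ℝ, P ≠ 0 → P' * T = P → P * L - G = P * (P' * U) →
      U / T = L / P - G / P ^ 2 := by
    intro P P' T U L G hP h3 h4
    have hT : T ≠ 0 := by rintro rfl; exact hP (by rw [← h3, mul_zero])
    have hP' : P' ≠ 0 := by rintro rfl; exact hP (by rw [← h3, zero_mul])
    rw [div_sub_div _ _ hP (pow_ne_zero 2 hP), div_eq_div_iff hT (by positivity)]
    rw [← h3] at h4 ⊢
    linear_combination -(P' * T) * T * h4
  exact (e _ _ _ _ _ _ hP (prod_range_succ _ _).symm h2).symm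

/-- The Levi form of `-2 log log (δ / φ_p)`. -/
theorem exists_hasLeviData_neg_log_log (hg : ∀ k, AnalyticAt ℂ (g k) z)
    (hy : IsOrthogonalSeq y) (h : ∀ l, jet g z l = y l + ∑ i ∈ range l, c l i • y i)
    (h0 : ∀ l ≤ p, normSqSum (y l) ≠ 0) (a : Fin (M + 1) → ℂ)
    (hc : ∑ l ∈ range (p + 1), lineContact a (y l) ≠ 0) {δ : ℝ} (hδ : 0 < δ)
    (hℓ : 0 < Real.log (δ / contactFunction g a p z)) :
    ∃ G, HasLeviData (fun w => -2 * Real.log (Real.log (δ / contactFunction g a p w))) z G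
      (normSqSum (y (p + 1)) / normSqSum (y p) *
        (((∑ l ∈ range p, lineContact a (y l)) * (∑ l ∈ range (p + 2), lineContact a (y l)) /
            (∑ l ∈ range (p + 1), lineContact a (y l)) ^ 2 - 1) /
              Real.log (δ / contactFunction g a p z) +
          lineContact a (y p) * lineContact a (y (p + 1)) /
            (∑ l ∈ range (p + 1), lineContact a (y l)) ^ 2 /
              (2 * Real.log (δ / contactFunction g a p z) ^ 2))) := by
  classical
  have hP : ∏ l ∈ range (p + 1), normSqSum (y l) ≠ 0 :=
    prod_ne_zero_iff.2 fun l hl => h0 l (by simpa [Nat.lt_succ_iff] using hl)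
  have hk : derivedNorm g p z ^ 2 ≠ 0 := by rw [derivedNorm_sq_frame hy h]; exact hP
  have hh : contactNorm g a p z ^ 2 ≠ 0 := by
    rw [contactNorm_sq_frame hy h]; exact mul_ne_zero hP hc
  have hA := (hasLeviData_contactNorm_sq (p := p) hg a)
  have hD := (hasLeviData_derivedNorm_sq (p := p) hg)
  -- Near z, log(δ/φ) is an affine combination of logarithms of squared norms, whose Levi data are
  -- known.
  have hev : (fun w => Real.log (δ / contactFunction g a p w)) =ᶠ[𝓝 z] fun w =>
      Real.log δ + ((-1 / 2) * Real.log (contactNorm g a p w ^ 2) +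
        (1 / 2) * Real.log (derivedNorm g p w ^ 2)) := by
    filter_upwards [hA.contDiffAt.continuousAt.eventually_ne hh,
      hD.contDiffAt.continuousAt.eventually_ne hk] with w hw1 hw2
    have hw1' : contactNorm g a p w ≠ 0 := fun h => hw1 (by simp [h])
    have hw2' : derivedNorm g p w ≠ 0 := fun h => hw2 (by simp [h])
    rw [contactFunction, Real.log_div hδ.ne' (div_ne_zero hw1' hw2'), Real.log_div hw1' hw2',
      Real.log_pow, Real.log_pow]
    push_cast
    ring
  have hL := ((HasLeviData.const (Real.log δ) z).add (((hA.log hh).const_mul (-1 / 2)).add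
    ((hD.log hk).const_mul (1 / 2)))).congr hev
  have hgrad := log_deriv_difference_frame (p := p) hy h a h0 hc
  have hlap := contraction_lagrange_frame (p := p) hy h a
  have hlap' := minorDet_lagrange_frame (p := p) hy h
  rw [← contactNorm_sq] at hgrad hlap
  rw [← derivedNorm_sq] at hgrad hlap'
  refine ((hL.log hℓ.ne').const_mul (-2)).exists_of_eq ?_
  -- The gradient of log(δ/φ) is -½ times the difference of the two logarithmic derivatives, hence
  -- the factor 1/4.
  have hnorm : ∀ X Y : ℂ, ‖0 + (((-1 / 2 : ℝ) : ℂ) * X + ((1 / 2 : ℝ) : ℂ) * Y)‖ ^ 2 =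
      ‖X - Y‖ ^ 2 / 4 := by
    intro X Y
    have : 0 + (((-1 / 2 : ℝ) : ℂ) * X + ((1 / 2 : ℝ) : ℂ) * Y) =
        ((-1 / 2 : ℝ) : ℂ) * (X - Y) := by push_cast; ring
    rw [this, norm_mul, Complex.norm_real, mul_pow, Real.norm_eq_abs, sq_abs]
    ring
  rw [hnorm, hgrad, ← div_sub_div_same_sq hh, ← div_sub_div_same_sq hk, hlap, hlap',
    contactNorm_sq_frame hy h, derivedNorm_sq_frame hy h]
  have hp : normSqSum (y p) ≠ 0 := h0 p le_rfl
  have hP' : ∏ l ∈ range p, normSqSum (y l) ≠ 0 := by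
    rw [prod_range_succ] at hP; exact left_ne_zero_of_mul hP
  rw [prod_range_succ _ p]
  have hl := hℓ.ne'
  field_simp
  ring

end LeviData

end GaussMap

namespace GaussMap

open Finset

/-! ### Forms of degree d on V: dimension and subgeneral position -/

section FormsOnV

variable {n d M : ℕ} {V : Set (PSpace n)} {v : Fin (M + 1) → Forms n d}
  {𝒱 : Module.Basis (Fin (M + 1)) ℂ (FormClasses V d)}

theorem sub_sum_repr_mem_vanishingIdeal (hv : ∀ i, 𝒱 i = formClass V (v i)) (P : Forms n d) :
    (P.1 - ∑ l, 𝒱.repr (formClass V P) l • (v l).1) ∈ vanishingIdeal V := by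
  have h1 : formClass V P = formClass V (∑ l, 𝒱.repr (formClass V P) l • v l) := by
    conv_lhs => rw [← 𝒱.sum_repr (formClass V P)]
    unfold formClass
    rw [← Submodule.mkQ_apply, ← Submodule.mkQ_apply, map_sum]
    refine sum_congr rfl fun l _ => ?_
    rw [map_smul, hv]
    rfl
  have h2 := (Submodule.Quotient.eq _).1 h1
  unfold vanishingForms at h2
  have h3 : (Forms n d).subtype (P - ∑ l, 𝒱.repr (formClass V P) l • v l) =
      P.1 - ∑ l, 𝒱.repr (formClass V P) l • (v l).1 := by
    simp
  rw [← h3]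
  exact h2

/-- Incomparability: contraction of primes along an integral map is strictly increasing. -/
theorem ringKrullDim_le_of_isIntegral {R A : Type*} [CommRing R] [CommRing A] [Algebra R A]
    [Algebra.IsIntegral R A] : ringKrullDim A ≤ ringKrullDim R :=
  Order.krullDim_le_of_strictMono
    (fun I : PrimeSpectrum A => ⟨I.asIdeal.comap (algebraMap R A), inferInstance⟩)
    fun I J hIJ => Ideal.IsIntegral.comap_lt_comap (I := I.asIdeal) (J := J.asIdeal) hIJ

/-- The dimension of `V` is less than the dimension of `I_d(V)`. -/
theorem HasDimension.le_of_basis {k : ℕ} (hd : 1 ≤ d) (hVk : HasDimension V k)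
    (hv : ∀ i, 𝒱 i = formClass V (v i)) : k ≤ M := by
  let A := MvPolynomial (Fin (n + 1)) ℂ ⧸ vanishingIdeal V
  let φ : MvPolynomial (Fin (M + 1)) ℂ →ₐ[ℂ] A :=
    MvPolynomial.aeval fun i => Ideal.Quotient.mk (vanishingIdeal V) (v i).1
  let _ : Algebra (MvPolynomial (Fin (M + 1)) ℂ) A := φ.toRingHom.toAlgebra
  have hφ : ∀ x, algebraMap (MvPolynomial (Fin (M + 1)) ℂ) A x = φ x := fun _ => rfl
  -- Modulo I(V), x_i^d is a linear combination of the v_l, so the coordinate ring is integral over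
  -- the polynomial ring in M+1 variables acting through the v_l. This bounds k+1 by M+1.
  have hX : ∀ i, IsIntegral (MvPolynomial (Fin (M + 1)) ℂ)
      (Ideal.Quotient.mk (vanishingIdeal V) (MvPolynomial.X i) : A) := by
    intro i
    refine IsIntegral.of_pow (n := d) hd ?_
    let P : Forms n d := ⟨MvPolynomial.X i ^ d, MvPolynomial.isHomogeneous_X_pow i d⟩
    have h := Ideal.Quotient.eq.2 (sub_sum_repr_mem_vanishingIdeal hv P)
    have h2 : (Ideal.Quotient.mk (vanishingIdeal V) (MvPolynomial.X i) : A) ^ d =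
        φ (∑ l, 𝒱.repr (formClass V P) l • MvPolynomial.X l) := by
      rw [← map_pow]
      refine h.trans ?_
      simp only [map_sum, map_smul, φ, MvPolynomial.aeval_X]
      rfl
    rw [h2, ← hφ]
    exact isIntegral_algebraMap
  have : Algebra.IsIntegral (MvPolynomial (Fin (M + 1)) ℂ) A := by
    refine ⟨fun x => ?_⟩
    obtain ⟨p, rfl⟩ := Ideal.Quotient.mk_surjective x
    induction p using MvPolynomial.induction_on with
    | C c =>
      have : (Ideal.Quotient.mk (vanishingIdeal V) (MvPolynomial.C c) : A) =
          algebraMap (MvPolynomial (Fin (M + 1)) ℂ) A (MvPolynomial.C c) := by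
        rw [hφ, ← MvPolynomial.algebraMap_eq, ← MvPolynomial.algebraMap_eq, AlgHom.commutes]
        rfl
      rw [this]
      exact isIntegral_algebraMap
    | add p q hp hq => rw [map_add]; exact hp.add hq
    | mul_X p i hp => rw [map_mul]; exact hp.mul (hX i)
  have h1 := ringKrullDim_le_of_isIntegral (R := MvPolynomial (Fin (M + 1)) ℂ) (A := A)
  have h2 : ringKrullDim A = ((k + 1 : ℕ) : WithBot ℕ∞) := hVk
  rw [h2, MvPolynomial.ringKrullDim_of_isNoetherianRing, ringKrullDim_eq_zero_of_field, zero_add,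
    Nat.card_fin] at h1
  have h3 : (k + 1 : ℕ) ≤ M + 1 := by exact_mod_cast h1
  omega

theorem eval_smul_of_isHomogeneous {σ : Type*} {P : MvPolynomial σ ℂ} {m : ℕ}
    (hP : P.IsHomogeneous m) (t : ℂ) (X : σ → ℂ) :
    MvPolynomial.eval (t • X) P = t ^ m * MvPolynomial.eval X P := by
  simp only [MvPolynomial.eval_eq, mul_sum]
  refine sum_congr rfl fun s hs => ?_
  have h1 := hP (MvPolynomial.mem_support_iff.1 hs)
  have h2 : ∑ i ∈ s.support, s i = m := by
    rw [← h1, Finsupp.weight_apply]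
    simp [Finsupp.sum]
  simp only [Pi.smul_apply, smul_eq_mul, mul_pow, prod_mul_distrib, prod_pow_eq_pow_sum, h2]
  ring

theorem vanishesAt_mk_iff {P : MvPolynomial (Fin (n + 1)) ℂ} {m : ℕ} (hP : P.IsHomogeneous m)
    {X : Fin (n + 1) → ℂ} (hX : X ≠ 0) :
    VanishesAt P (Projectivization.mk ℂ X hX) ↔ MvPolynomial.eval X P = 0 := by
  obtain ⟨t, ht⟩ := Projectivization.exists_smul_eq_mk_rep ℂ X hX
  unfold VanishesAt
  rw [← ht, Units.smul_def, eval_smul_of_isHomogeneous hP]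
  simp

theorem eval_eq_zero_of_mem_vanishingIdeal {P : MvPolynomial (Fin (n + 1)) ℂ}
    (hP : P ∈ vanishingIdeal V) {X : Fin (n + 1) → ℂ} (hX : X ≠ 0)
    (hXV : Projectivization.mk ℂ X hX ∈ V) : MvPolynomial.eval X P = 0 := by
  have : vanishingIdeal V ≤ RingHom.ker (MvPolynomial.eval X) := by
    refine Ideal.span_le.2 ?_
    rintro P ⟨⟨m, hm⟩, hP⟩
    exact (vanishesAt_mk_iff hm hX).1 (hP _ hXV)
  exact this hP

theorem eval_eq_sum_repr (hv : ∀ i, 𝒱 i = formClass V (v i)) (P : Forms n d)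
    {X : Fin (n + 1) → ℂ} (hX : X ≠ 0) (hXV : Projectivization.mk ℂ X hX ∈ V) :
    MvPolynomial.eval X P.1 =
      ∑ l, 𝒱.repr (formClass V P) l * MvPolynomial.eval X (v l).1 := by
  have := eval_eq_zero_of_mem_vanishingIdeal (sub_sum_repr_mem_vanishingIdeal hv P) hX hXV
  rw [map_sub, map_sum, sub_eq_zero] at this
  simpa [MvPolynomial.smul_eval] using this

theorem isClosed_affineCone (hV : IsProjectiveAlgebraic V) :
    ∃ K : Set (Fin (n + 1) → ℂ), IsClosed K ∧
      ∀ X (hX : X ≠ 0), X ∈ K ↔ Projectivization.mk ℂ X hX ∈ V := by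
  obtain ⟨A, hA, rfl⟩ := hV
  refine ⟨{X | ∀ P ∈ A, MvPolynomial.eval X P = 0}, ?_, fun X hX => ?_⟩
  · simp only [Set.ofPred_forall]
    exact isClosed_iInter fun P => isClosed_iInter fun _ =>
      isClosed_eq (MvPolynomial.continuous_eval P) continuous_const
  · refine forall₂_congr fun P hP => ?_
    obtain ⟨m, hm⟩ := hA P hP
    exact (vanishesAt_mk_iff hm hX).symm

/-- On the unit sphere of the affine cone over V, which is compact, the right side is positive. All
forms have degree d, so both sides scale alike and the bound extends to the whole cone. -/
theorem exists_mul_le_sum_norm_sq_eval {q : ℕ} (hV : IsProjectiveAlgebraic V)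
    (v : Fin (M + 1) → Forms n d) (Q : Fin q → Forms n d) (R : Finset (Fin q))
    (hR : ¬ ∃ x ∈ V, ∀ j ∈ R, VanishesAt (Q j).1 x) :
    ∃ c > 0, ∀ X (hX : X ≠ 0), Projectivization.mk ℂ X hX ∈ V →
      c * ∑ i, ‖MvPolynomial.eval X (v i).1‖ ^ 2 ≤ ∑ j ∈ R, ‖MvPolynomial.eval X (Q j).1‖ ^ 2 := by
  obtain ⟨K, hK, hKV⟩ := isClosed_affineCone hV
  have hcomp : IsCompact (Metric.sphere (0 : Fin (n + 1) → ℂ) 1 ∩ K) :=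
    (isCompact_sphere _ _).inter_right hK
  have hcont : ∀ P : Forms n d, Continuous fun X => ‖MvPolynomial.eval X P.1‖ ^ 2 := fun P =>
    (MvPolynomial.continuous_eval P.1).norm.pow 2
  let S : (Fin (n + 1) → ℂ) → ℝ := fun X => ∑ j ∈ R, ‖MvPolynomial.eval X (Q j).1‖ ^ 2
  let T : (Fin (n + 1) → ℂ) → ℝ := fun X => ∑ i, ‖MvPolynomial.eval X (v i).1‖ ^ 2
  have hS : Continuous S := continuous_finsetSum _ fun j _ => hcont _
  have hT : Continuous T := continuous_finsetSum _ fun j _ => hcont _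
  have hne : ∀ X ∈ Metric.sphere (0 : Fin (n + 1) → ℂ) 1, X ≠ 0 := by
    rintro X hX rfl
    simp at hX
  have hSpos : ∀ X ∈ Metric.sphere (0 : Fin (n + 1) → ℂ) 1 ∩ K, 0 < S X := by
    rintro X ⟨hX, hXK⟩
    refine lt_of_le_of_ne (sum_nonneg fun _ _ => by positivity) fun h => hR ?_
    refine ⟨_, (hKV X (hne X hX)).1 hXK, fun j hj => ?_⟩
    rw [vanishesAt_mk_iff (Q j).2]
    have := (sum_eq_zero_iff_of_nonneg fun _ _ => by positivity).1 h.symm j hj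
    simpa using this
  obtain ⟨c, hc, hcS⟩ : ∃ c > 0, ∀ X ∈ Metric.sphere (0 : Fin (n + 1) → ℂ) 1 ∩ K,
      c * T X ≤ S X := by
    have hTS : ContinuousOn (fun X => T X / S X) (Metric.sphere (0 : Fin (n + 1) → ℂ) 1 ∩ K) :=
      hT.continuousOn.div hS.continuousOn fun X hX => (hSpos X hX).ne'
    obtain ⟨B, hB⟩ := (hcomp.image_of_continuousOn hTS).bddAbove
    -- |B| + 1 is positive whatever the bound B is, even if the compact set is empty.
    refine ⟨1 / (|B| + 1), by positivity, fun X hX => ?_⟩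
    have h1 : T X / S X ≤ |B| + 1 :=
      (hB (Set.mem_image_of_mem _ hX)).trans ((le_abs_self B).trans (by linarith))
    rw [div_le_iff₀ (hSpos X hX)] at h1
    rw [div_mul_eq_mul_div, one_mul, div_le_iff₀ (by positivity)]
    linarith
  refine ⟨c, hc, fun X hX hXV => ?_⟩
  have hX0 : (‖X‖ : ℂ) ≠ 0 := by exact_mod_cast norm_ne_zero_iff.2 hX
  set Y : Fin (n + 1) → ℂ := (‖X‖ : ℂ)⁻¹ • X with hY
  have hXY : X = (‖X‖ : ℂ) • Y := by rw [hY, smul_inv_smul₀ hX0]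
  have hYs : Y ∈ Metric.sphere (0 : Fin (n + 1) → ℂ) 1 := by
    rw [mem_sphere_zero_iff_norm, hY, norm_smul, norm_inv, Complex.norm_real, norm_norm,
      inv_mul_cancel₀ (norm_ne_zero_iff.2 hX)]
  have hYV : Projectivization.mk ℂ Y (hne Y hYs) ∈ V := by
    have : Projectivization.mk ℂ Y (hne Y hYs) = Projectivization.mk ℂ X hX :=
      (Projectivization.mk_eq_mk_iff' ℂ _ _ _ _).2 ⟨(‖X‖ : ℂ)⁻¹, rfl⟩
    rwa [this]
  have hev : ∀ P : Forms n d, ‖MvPolynomial.eval X P.1‖ ^ 2 =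
      (‖X‖ ^ d) ^ 2 * ‖MvPolynomial.eval Y P.1‖ ^ 2 := by
    intro P
    conv_lhs => rw [hXY]
    rw [eval_smul_of_isHomogeneous P.2, norm_mul, norm_pow, Complex.norm_real, norm_norm, mul_pow]
  have := hcS Y ⟨hYs, (hKV Y _).2 hYV⟩
  simp only [hev, ← mul_sum]
  rw [mul_left_comm]
  exact mul_le_mul_of_nonneg_left this (by positivity)

theorem InSubgeneralPosition.exists_forall_exists_le {q N : ℕ} (hV : IsProjectiveAlgebraic V)
    (v : Fin (M + 1) → Forms n d) {Q : Fin q → Forms n d} (hpos : InSubgeneralPosition V N Q) :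
    ∃ c > 0, ∀ X (hX : X ≠ 0), Projectivization.mk ℂ X hX ∈ V →
      ∀ R : Finset (Fin q), R.card = N + 1 → ∃ j ∈ R,
        c * ∑ i, ‖MvPolynomial.eval X (v i).1‖ ^ 2 ≤ ‖MvPolynomial.eval X (Q j).1‖ ^ 2 := by
  have h : ∀ R : Finset (Fin q), ∃ c > 0, R.card = N + 1 →
      ∀ X (hX : X ≠ 0), Projectivization.mk ℂ X hX ∈ V →
      c * ∑ i, ‖MvPolynomial.eval X (v i).1‖ ^ 2 ≤
        ∑ j ∈ R, ‖MvPolynomial.eval X (Q j).1‖ ^ 2 := by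
    intro R
    by_cases hR : R.card = N + 1
    · obtain ⟨c, hc, h⟩ := exists_mul_le_sum_norm_sq_eval hV v Q R (hpos R hR)
      exact ⟨c, hc, fun _ => h⟩
    · exact ⟨1, one_pos, fun h => absurd h hR⟩
  choose c hc h using h
  obtain ⟨R₀, hR₀⟩ := Finite.exists_min c
  -- The least of the finitely many constants, shared among the N+1 terms: some term is at least the
  -- average.
  refine ⟨c R₀ / (N + 1), by have := hc R₀; positivity, fun X hX hXV R hR => ?_⟩
  by_contra! hlt
  have hRne : R.Nonempty := card_pos.1 (by omega)
  have h1 := sum_lt_sum_of_nonempty hRne hlt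
  rw [sum_const, hR, nsmul_eq_mul] at h1
  have h2 := h R hR X hX hXV
  have h3 : c R₀ * ∑ i, ‖MvPolynomial.eval X (v i).1‖ ^ 2 ≤
      c R * ∑ i, ‖MvPolynomial.eval X (v i).1‖ ^ 2 :=
    mul_le_mul_of_nonneg_right (hR₀ R) (sum_nonneg fun _ _ => by positivity)
  have h4 : ((N + 1 : ℕ) : ℝ) * (c R₀ / (N + 1) * ∑ i, ‖MvPolynomial.eval X (v i).1‖ ^ 2) =
      c R₀ * ∑ i, ‖MvPolynomial.eval X (v i).1‖ ^ 2 := by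
    push_cast
    field_simp
  linarith

end FormsOnV

end GaussMap

namespace GaussMap

open Finset Matrix

/-! ### Independent functionals on a span of orthogonal vectors -/

section LineContact

variable {n : ℕ} {y : ℕ → Fin n → ℂ}

theorem lineContact_le (a x : Fin n → ℂ) : lineContact a x ≤ normSqSum a := by
  refine div_le_of_le_mul₀ (normSqSum_nonneg x) (normSqSum_nonneg a) ?_
  calc ‖x ⬝ᵥ a‖ ^ 2 ≤ (∑ k, ‖a k‖ * ‖x k‖) ^ 2 := by
        gcongr
        refine (norm_sum_le _ _).trans (sum_le_sum fun k _ => ?_)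
        rw [norm_mul, mul_comm]
    _ ≤ normSqSum a * normSqSum x := sum_mul_sq_le_sq_mul_sq _ _ _

theorem dotProduct_sum_smul_star {m : ℕ} (hy : IsOrthogonalSeq y) (s : Fin m → ℂ) (l : Fin m) :
    y l ⬝ᵥ (∑ i, s i • star (y i)) = s l * normSqSum (y l) := by
  rw [dotProduct_sum, sum_eq_single l]
  · rw [dotProduct_smul, dotProduct_star_self_eq, smul_eq_mul]
  · intro i _ hi
    rw [dotProduct_smul, hy _ _ fun h => hi (Fin.val_injective h).symm, smul_zero]
  · simp

/-- Parseval. The pairing with functionals is bilinear, so the functionals carried by the span of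
the y_l are the combinations of the conjugates `star (y l)`. -/
theorem normSqSum_sum_smul_star {m : ℕ} (hy : IsOrthogonalSeq y) (s : Fin m → ℂ) :
    normSqSum (∑ i, s i • star (y i)) =
      ∑ l : Fin m, lineContact (∑ i, s i • star (y i)) (y l) := by
  set α := ∑ i, s i • star (y i) with hα
  have h1 : (normSqSum α : ℂ) = ∑ l : Fin m, ((‖s l‖ ^ 2 * normSqSum (y l) : ℝ) : ℂ) := by
    rw [← dotProduct_star_self_eq, dotProduct_comm]
    nth_rewrite 1 [hα]
    rw [star_sum, sum_dotProduct]
    refine sum_congr rfl fun l _ => ?_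
    rw [star_smul, star_star, smul_dotProduct, hα, dotProduct_sum_smul_star hy, smul_eq_mul,
      ← mul_assoc, mul_comm (star (s l))]
    have : s l * star (s l) = ((‖s l‖ ^ 2 : ℝ) : ℂ) := by
      rw [← Complex.normSq_eq_norm_sq, ← Complex.mul_conj]; rfl
    rw [this]
    push_cast
    ring
  rw [← Complex.ofReal_sum] at h1
  rw [Complex.ofReal_injective h1]
  refine sum_congr rfl fun l _ => ?_
  rw [lineContact, hα, dotProduct_sum_smul_star hy, norm_mul, Complex.norm_real, mul_pow,
    Real.norm_eq_abs, sq_abs]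
  by_cases h : normSqSum (y l) = 0
  · simp [h]
  · field_simp

theorem lineContact_sum_smul_le {ι : Type*} [Fintype ι] (b : ι → ℂ) (a : ι → Fin n → ℂ)
    (x : Fin n → ℂ) :
    lineContact (∑ j, b j • a j) x ≤ (∑ j, ‖b j‖ ^ 2) * ∑ j, lineContact (a j) x := by
  have h : ‖x ⬝ᵥ ∑ j, b j • a j‖ ^ 2 ≤ (∑ j, ‖b j‖ ^ 2) * ∑ j, ‖x ⬝ᵥ a j‖ ^ 2 := by
    calc ‖x ⬝ᵥ ∑ j, b j • a j‖ ^ 2 ≤ (∑ j, ‖b j‖ * ‖x ⬝ᵥ a j‖) ^ 2 := by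
          gcongr
          rw [dotProduct_sum]
          refine (norm_sum_le _ _).trans (sum_le_sum fun k _ => ?_)
          rw [dotProduct_smul, norm_smul]
      _ ≤ _ := sum_mul_sq_le_sq_mul_sq _ _ _
  unfold lineContact
  rw [← sum_div, ← mul_div_assoc]
  exact div_le_div_of_nonneg_right h (normSqSum_nonneg x)

/-- An injective linear map on a finite-dimensional space is bounded below. -/
theorem exists_mul_le_normSqSum_sum_smul {ι : Type*} [Fintype ι] {a : ι → Fin n → ℂ}
    (ha : LinearIndependent ℂ a) :
    ∃ κ > 0, ∀ b : ι → ℂ, κ * ∑ j, ‖b j‖ ^ 2 ≤ normSqSum (∑ j, b j • a j) := by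
  let f : EuclideanSpace ℂ ι →ₗ[ℂ] EuclideanSpace ℂ (Fin n) :=
    (WithLp.linearEquiv 2 ℂ (Fin n → ℂ)).symm.toLinearMap ∘ₗ
      (Fintype.linearCombination ℂ a) ∘ₗ (WithLp.linearEquiv 2 ℂ (ι → ℂ)).toLinearMap
  have hf : f.ker = ⊥ := by
    refine LinearMap.ker_eq_bot'.2 fun x hx => ?_
    have hx' : ∑ j, x.ofLp j • a j = 0 := congrArg WithLp.ofLp hx
    ext j
    exact Fintype.linearIndependent_iff.1 ha _ hx' j
  obtain ⟨K, hK, hKf⟩ := f.exists_antilipschitzWith hf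
  refine ⟨1 / (K : ℝ) ^ 2, by positivity, fun b => ?_⟩
  have h := hKf.le_mul_dist (WithLp.toLp 2 b) 0
  rw [map_zero, dist_zero_right, dist_zero_right] at h
  have h1 : ‖WithLp.toLp 2 b‖ ^ 2 = ∑ j, ‖b j‖ ^ 2 := EuclideanSpace.norm_sq_eq _
  have h2 : ‖f (WithLp.toLp 2 b)‖ ^ 2 = normSqSum (∑ j, b j • a j) := by
    rw [EuclideanSpace.norm_sq_eq]
    rfl
  have h3 := pow_le_pow_left₀ (norm_nonneg _) h 2
  rw [mul_pow, h1, h2] at h3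
  rw [div_mul_eq_mul_div, one_mul, div_le_iff₀ (by positivity), mul_comm]
  exact h3

/-- Linearly independent functionals whose number exceeds the codimension of a subspace cannot all
be small on it. -/
theorem exists_le_sum_lineContact {ι : Type*} [Fintype ι] {a : ι → Fin n → ℂ}
    (ha : LinearIndependent ℂ a) :
    ∃ κ > 0, ∀ (y : ℕ → Fin n → ℂ) (m : ℕ), IsOrthogonalSeq y → (∀ l < m, normSqSum (y l) ≠ 0) →
      n < Fintype.card ι + m → ∃ j, κ ≤ ∑ l ∈ range m, lineContact (a j) (y l) := by
  obtain ⟨κ, hκ, h⟩ := exists_mul_le_normSqSum_sum_smul ha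
  refine ⟨κ / (Fintype.card ι + 1), by positivity, fun y m hy h0 hcard => ?_⟩
  -- There are more than n vectors, so some combination of the a_j lies in the span of the
  -- conjugates of the y_l. By Parseval its whole norm is seen by its line contacts, which therefore
  -- cannot all be small.
  have hdep : ¬ LinearIndependent ℂ
      (Sum.elim a fun l : Fin m => star (y l) : ι ⊕ Fin m → Fin n → ℂ) := by
    intro hli
    have := hli.fintype_card_le_finrank
    simp at this
    omega
  obtain ⟨g, hg, i, hi⟩ := Fintype.not_linearIndependent_iff.1 hdep
  rw [Fintype.sum_sum_type] at hg
  simp only [Sum.elim_inl, Sum.elim_inr] at hg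
  set b : ι → ℂ := fun j => g (Sum.inl j)
  set s : Fin m → ℂ := fun l => -g (Sum.inr l) with hs
  have hbs : ∑ j, b j • a j = ∑ l, s l • star (y l) := by
    rw [eq_neg_of_add_eq_zero_left hg, ← sum_neg_distrib]
    exact sum_congr rfl fun l _ => by rw [hs, neg_smul]
  -- The relation must involve some a_j, because the y_l are orthogonal and nonzero.
  have hb : ∑ j, ‖b j‖ ^ 2 ≠ 0 := by
    intro hb0
    have hb1 : ∀ j, b j = 0 := fun j => by
      have := (sum_eq_zero_iff_of_nonneg fun _ _ => by positivity).1 hb0 j (mem_univ j)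
      simpa using this
    have hz : ∑ l, s l • star (y l) = 0 := by rw [← hbs]; simp [hb1]
    have hs1 : ∀ l, s l = 0 := fun l => by
      have := dotProduct_sum_smul_star hy s l
      rw [hz, dotProduct_zero] at this
      exact (mul_eq_zero.1 this.symm).resolve_right (by exact_mod_cast h0 l l.2)
    rcases i with j | l
    · exact hi (hb1 j)
    · exact hi (neg_eq_zero.1 (hs1 l))
  have hbpos : 0 < ∑ j, ‖b j‖ ^ 2 :=
    lt_of_le_of_ne (sum_nonneg fun _ _ => by positivity) hb.symm
  by_contra! hlt
  have h1 : κ * ∑ j, ‖b j‖ ^ 2 ≤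
      (∑ j, ‖b j‖ ^ 2) * ∑ j, ∑ l ∈ range m, lineContact (a j) (y l) := by
    calc κ * ∑ j, ‖b j‖ ^ 2 ≤ normSqSum (∑ j, b j • a j) := h b
      _ = ∑ l : Fin m, lineContact (∑ j, b j • a j) (y l) := by
        rw [hbs]; exact normSqSum_sum_smul_star hy s
      _ ≤ ∑ l : Fin m, (∑ j, ‖b j‖ ^ 2) * ∑ j, lineContact (a j) (y l) :=
        sum_le_sum fun l _ => lineContact_sum_smul_le _ _ _
      _ = _ := by
        rw [← mul_sum, sum_comm]
        congr 1
        exact sum_congr rfl fun j _ => (Finset.sum_range fun l => lineContact (a j) (y l)).symm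
  have h2 : ∑ j, ∑ l ∈ range m, lineContact (a j) (y l) ≤
      ∑ _j : ι, κ / (Fintype.card ι + 1) := sum_le_sum fun j _ => (hlt j).le
  rw [sum_const, card_univ, nsmul_eq_mul] at h2
  have h3 : (Fintype.card ι : ℝ) * (κ / (Fintype.card ι + 1)) < κ := by
    rw [← mul_div_assoc, div_lt_iff₀ (by positivity)]
    nlinarith
  nlinarith

theorem exists_forall_exists_le_sum_lineContact {q : ℕ} (a : Fin q → Fin n → ℂ) :
    ∃ κ > 0, ∀ (T : Finset (Fin q)), LinearIndependent ℂ (fun j : T => a j) →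
      ∀ (y : ℕ → Fin n → ℂ) (m : ℕ), IsOrthogonalSeq y → (∀ l < m, normSqSum (y l) ≠ 0) →
      n < T.card + m → ∃ j ∈ T, κ ≤ ∑ l ∈ range m, lineContact (a j) (y l) := by
  have h : ∀ T : Finset (Fin q), ∃ κ > 0, LinearIndependent ℂ (fun j : T => a j) →
      ∀ (y : ℕ → Fin n → ℂ) (m : ℕ), IsOrthogonalSeq y → (∀ l < m, normSqSum (y l) ≠ 0) →
      n < T.card + m → ∃ j ∈ T, κ ≤ ∑ l ∈ range m, lineContact (a j) (y l) := by
    intro T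
    by_cases hT : LinearIndependent ℂ (fun j : T => a j)
    · obtain ⟨κ, hκ, h⟩ := exists_le_sum_lineContact hT
      refine ⟨κ, hκ, fun _ y m hy h0 hc => ?_⟩
      obtain ⟨j, hj⟩ := h y m hy h0 (by simpa using hc)
      exact ⟨j, j.2, hj⟩
    · exact ⟨1, one_pos, fun h => absurd h hT⟩
  choose κ hκ h using h
  obtain ⟨T₀, hT₀⟩ := Finite.exists_min κ
  refine ⟨κ T₀, hκ T₀, fun T hT y m hy h0 hc => ?_⟩
  obtain ⟨j, hj, hle⟩ := h T hT y m hy h0 hc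
  exact ⟨j, hj, (hT₀ T).trans hle⟩

end LineContact

/-! ### The product estimate from Nochka weights -/

section NochkaProduct

variable {n d k N q : ℕ} {V : Set (PSpace n)} {Q : Fin q → Forms n d} {wt : Fin q → ℝ}

theorem linearIndependent_of_finrank_span_image {T : Finset (Fin q)} {m : ℕ} (hm : T.card = m)
    (h : Module.finrank ℂ (Submodule.span ℂ ((fun j => formClass V (Q j)) '' (T : Set (Fin q))))
      = m) : LinearIndependent ℂ (fun j : T => formClass V (Q j)) := by
  have hr : Set.range (fun j : T => formClass V (Q j)) =
      (fun j => formClass V (Q j)) '' (T : Set (Fin q)) := by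
    ext x
    simp
  rw [linearIndependent_iff_card_eq_finrank_span, Fintype.card_coe, hm, Set.finrank, hr, h]

/-- The product `∏ Ξ_j ^ ω_j` is bounded in terms of the sum of the `Ξ_j` if few of them are
large. -/
theorem IsNochkaWeights.prod_rpow_le (hwt : IsNochkaWeights V k N Q wt) (hNq : N + 1 ≤ q)
    {Ξ : Fin q → ℝ} (hΞ : ∀ j, 0 ≤ Ξ j) {B : ℝ} (hB : 0 ≤ B) {m : ℕ}
    (h1 : ∀ R : Finset (Fin q), R.card = N + 1 → ∃ j ∈ R, Ξ j ≤ B)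
    (h2 : ∀ T : Finset (Fin q), LinearIndependent ℂ (fun j : T => formClass V (Q j)) →
      T.card = m + 1 → ∃ j ∈ T, Ξ j ≤ B) :
    ∏ j, Ξ j ^ wt j ≤ (1 + B) ^ (2 * q) * (1 + ∑ j, Ξ j) ^ m := by
  classical
  set L : Finset (Fin q) := univ.filter fun j => B < Ξ j with hL
  have hLN : L.card ≤ N + 1 := by
    by_contra! hlt
    obtain ⟨R, hRL, hR⟩ := exists_subset_card_eq hlt.le
    obtain ⟨j, hj, hjB⟩ := h1 R hR
    exact absurd hjB (not_le.2 (mem_filter.1 (hRL hj)).2)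
  -- All large indices go into one R of N+1 elements. The Nochka inequality is applied to E_j = 1 +
  -- Ξ_j, which satisfies E_j ≥ 1.
  obtain ⟨R, hLR, -, hR⟩ := exists_subsuperset_card_eq (subset_univ L) hLN (by simpa using hNq)
  have hE : ∀ j, 1 ≤ 1 + Ξ j := fun j => by linarith [hΞ j]
  obtain ⟨R', hR'R, hR'card, hR'rank, hprod⟩ := hwt.prod_le (fun j => 1 + Ξ j) hE R hR
  have hind := linearIndependent_of_finrank_span_image hR'card hR'rank
  have hS : ∀ j, 1 + Ξ j ≤ 1 + ∑ i, Ξ i := fun j => by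
    have := single_le_sum (fun i _ => hΞ i) (mem_univ j)
    linarith
  have hS1 : 1 ≤ 1 + ∑ i, Ξ i := by linarith [sum_nonneg fun i (_ : i ∈ univ) => hΞ i]
  have hB1 : 1 ≤ 1 + B := by linarith
  have hsmall : ∀ j, j ∉ L → 1 + Ξ j ≤ 1 + B := fun j hj => by
    simp only [hL, mem_filter, mem_univ, true_and, not_lt] at hj
    linarith
  -- The classes indexed by R' are independent, so m+1 large ones among them would contradict `h2`.
  have hfew : (R' ∩ L).card ≤ m := by
    by_contra! hlt
    obtain ⟨T, hT, hTc⟩ := exists_subset_card_eq (Nat.succ_le_of_lt hlt)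
    have hTR' : T ⊆ R' := hT.trans inter_subset_left
    have hTind : LinearIndependent ℂ (fun j : T => formClass V (Q j)) :=
      hind.comp (fun j : T => (⟨j, hTR' j.2⟩ : R')) fun i j hij =>
        Subtype.ext (congrArg (fun x : R' => (x : Fin q)) hij)
    obtain ⟨j, hj, hjB⟩ := h2 T hTind hTc
    exact absurd hjB (not_le.2 (mem_filter.1 (inter_subset_right (hT hj))).2)
  have hR'prod : ∏ j ∈ R', (1 + Ξ j) ≤ (1 + B) ^ q * (1 + ∑ i, Ξ i) ^ m := by
    rw [← prod_inter_mul_prod_sdiff R' L, mul_comm]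
    refine mul_le_mul ?_ ?_ (prod_nonneg fun j _ => by linarith [hE j]) (by positivity)
    · calc ∏ j ∈ R' \ L, (1 + Ξ j) ≤ ∏ _j ∈ R' \ L, (1 + B) :=
            prod_le_prod (fun j _ => by linarith [hE j]) fun j hj => hsmall j (mem_sdiff.1 hj).2
        _ ≤ (1 + B) ^ q := by
            rw [prod_const]
            exact pow_le_pow_right₀ hB1 (by simpa using card_le_univ (R' \ L))
    · calc ∏ j ∈ R' ∩ L, (1 + Ξ j) ≤ ∏ _j ∈ R' ∩ L, (1 + ∑ i, Ξ i) :=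
            prod_le_prod (fun j _ => by linarith [hE j]) fun j _ => hS j
        _ ≤ _ := by
            rw [prod_const]
            exact pow_le_pow_right₀ hS1 hfew
  have hRc : ∏ j ∈ Rᶜ, (1 + Ξ j) ^ wt j ≤ (1 + B) ^ q := by
    calc ∏ j ∈ Rᶜ, (1 + Ξ j) ^ wt j ≤ ∏ _j ∈ Rᶜ, (1 + B) := by
          refine prod_le_prod (fun j _ => by have := hE j; positivity) fun j hj => ?_
          calc (1 + Ξ j) ^ wt j ≤ (1 + Ξ j) ^ (1 : ℝ) :=
                Real.rpow_le_rpow_of_exponent_le (hE j) (hwt.le_one j)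
            _ ≤ 1 + B := by
                rw [Real.rpow_one]
                exact hsmall j fun h => (mem_compl.1 hj) (hLR h)
      _ ≤ (1 + B) ^ q := by
          rw [prod_const]
          exact pow_le_pow_right₀ hB1 (by simpa using card_le_univ Rᶜ)
  calc ∏ j, Ξ j ^ wt j ≤ ∏ j, (1 + Ξ j) ^ wt j :=
        prod_le_prod (fun j _ => Real.rpow_nonneg (hΞ j) _) fun j _ =>
          Real.rpow_le_rpow (hΞ j) (by linarith) (hwt.pos j).le
    _ = (∏ j ∈ R, (1 + Ξ j) ^ wt j) * ∏ j ∈ Rᶜ, (1 + Ξ j) ^ wt j := (prod_mul_prod_compl R _).symm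
    _ ≤ ((1 + B) ^ q * (1 + ∑ i, Ξ i) ^ m) * (1 + B) ^ q :=
        mul_le_mul (hprod.trans hR'prod) hRc
          (prod_nonneg fun j _ => Real.rpow_nonneg (by linarith [hE j]) _) (by positivity)
    _ = _ := by rw [two_mul, pow_add]; ring

end NochkaProduct

end GaussMap

namespace GaussMap

open Finset Matrix Filter Topology

/-! ### Elementary real inequalities and telescoping products -/

section RealEstimates

/-- Here x = Θ_p, v = τ_p, w = τ_{p+1}. Since ℓ ≥ 1, the first 1/ℓ may be weakened to 1/(2ℓ²), after
which x(s+w) + vw = s(s+w) - vs with s = x+v. The losses are 1/ℓ and at most 1/(2ℓ). -/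
theorem levi_bracket_ge {x v w ℓ : ℝ} (hx : 0 ≤ x) (hw : 0 ≤ w) (hs : 0 < x + v)
    (hℓ : 1 ≤ ℓ) :
    1 / 2 * ((x + v + w) / ((x + v) * ℓ ^ 2)) - 3 / (2 * ℓ) ≤
      (x * (x + v + w) / (x + v) ^ 2 - 1) / ℓ + v * w / (x + v) ^ 2 / (2 * ℓ ^ 2) := by
  have hℓ0 : 0 < ℓ := by linarith
  set s := x + v with hsdef
  have h1 : x * (s + w) / s ^ 2 / (2 * ℓ ^ 2) ≤ x * (s + w) / s ^ 2 / ℓ := by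
    apply div_le_div_of_nonneg_left (by positivity) hℓ0
    nlinarith
  have h2 : 1 / (2 * ℓ ^ 2) ≤ 1 / (2 * ℓ) :=
    one_div_le_one_div_of_le (by positivity) (by nlinarith)
  have h3 : x * (s + w) / s ^ 2 / (2 * ℓ ^ 2) + v * w / s ^ 2 / (2 * ℓ ^ 2) =
      1 / 2 * ((s + w) / (s * ℓ ^ 2)) - v / s * (1 / (2 * ℓ ^ 2)) := by
    have hx' : x = s - v := by rw [hsdef]; ring
    rw [hx']
    field_simp
    ring
  have h4 : v / s * (1 / (2 * ℓ ^ 2)) ≤ 1 / (2 * ℓ ^ 2) :=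
    mul_le_of_le_one_left (by positivity) ((div_le_one hs).2 (by linarith))
  have h5 : (x * (s + w) / s ^ 2 - 1) / ℓ = x * (s + w) / s ^ 2 / ℓ - 1 / ℓ := sub_div _ _ _
  have h6 : 3 / (2 * ℓ) = 1 / ℓ + 1 / (2 * ℓ) := by field_simp; ring
  rw [h5, h6]
  linarith

/-- For l ≥ 1, t_l occurs with exponent (M-l+1) - (M-l) = 1, and t_0 with exponent -M. -/
theorem prod_div_pow_eq {t : ℕ → ℝ} (M : ℕ) (ht : ∀ l ≤ M, t l ≠ 0) :
    ∏ p ∈ range M, (t (p + 1) / t p) ^ (M - p) = (∏ l ∈ range (M + 1), t l) / t 0 ^ (M + 1) := by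
  induction M with
  | zero => simp [ht 0 le_rfl]
  | succ M ih =>
    have h1 : ∏ p ∈ range (M + 1), (t (p + 1) / t p) ^ (M + 1 - p) =
        (∏ p ∈ range (M + 1), (t (p + 1) / t p) ^ (M - p)) *
          ∏ p ∈ range (M + 1), (t (p + 1) / t p) := by
      rw [← prod_mul_distrib]
      refine prod_congr rfl fun p hp => ?_
      rw [← pow_succ, Nat.succ_sub (Nat.lt_succ_iff.1 (mem_range.1 hp))]
    have h2 : ∏ p ∈ range (M + 1), t (p + 1) / t p = t (M + 1) / t 0 := by
      clear h1 ih
      have : ∀ m ≤ M + 1, ∏ p ∈ range m, t (p + 1) / t p = t m / t 0 := by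
        intro m hm
        induction m with
        | zero => simp [ht 0 (Nat.zero_le _)]
        | succ m ihm =>
          rw [prod_range_succ, ihm (by omega)]
          have := ht m (by omega)
          have := ht 0 (by omega)
          field_simp
      exact this _ le_rfl
    rw [h1, h2, prod_range_succ _ M, Nat.sub_self, pow_zero, mul_one,
      ih fun l hl => ht l (by omega), prod_range_succ _ (M + 1), div_mul_div_comm, ← pow_succ]

theorem prod_ratio_eq {Θ : ℕ → ℝ} (m : ℕ) (h : ∀ l, 1 ≤ l → l ≤ m + 1 → Θ l ≠ 0) :
    ∏ p ∈ range m, Θ (p + 2) / Θ (p + 1) = Θ (m + 1) / Θ 1 := by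
  induction m with
  | zero => simp [h 1 le_rfl le_rfl]
  | succ m ih =>
    rw [prod_range_succ, ih fun l h1 h2 => h l h1 (by omega)]
    have := h (m + 1) (by omega) (by omega)
    have := h 1 le_rfl (by omega)
    field_simp

theorem two_mul_sum_sub (M : ℕ) : 2 * ∑ p ∈ range M, (M - p) = M * (M + 1) := by
  rw [← sum_range_reflect]
  have : ∑ j ∈ range M, (M - (M - 1 - j)) = ∑ j ∈ range M, (j + 1) :=
    sum_congr rfl fun j hj => by have := mem_range.1 hj; omega
  have h2 : ∑ j ∈ range M, (j + 1) = ∑ j ∈ range (M + 1), j := by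
    rw [Finset.sum_range_succ', add_zero]
  rw [this, h2, mul_comm, Finset.sum_range_id_mul_two, Nat.add_sub_cancel, mul_comm]

variable {q M : ℕ}

/-- The exponents M-p in `hprod` match those with which the Ω_p = t_{p+1}/t_p telescope, so each
factor is a power of Ω_p(1 + ∑Ξ), at most C Ω_p T_p. Bounding each Ω_p T_p by the full sum replaces
the usual mean inequality. -/
theorem weighted_quotient_le {t : ℕ → ℝ} (ht : ∀ l ≤ M, 0 < t l) {Θ ℓ : Fin q → ℕ → ℝ}
    (hΘ : ∀ j l, 1 ≤ l → l ≤ M + 1 → 0 < Θ j l) (hℓ : ∀ j, ∀ p < M, 1 ≤ ℓ j p) {wt : Fin q → ℝ}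
    (hwt0 : ∀ j, 0 < wt j) (hwt1 : ∀ j, wt j ≤ 1) {κ : ℝ} (hκ : 0 < κ) (hκ1 : κ ≤ 1)
    (hκΘ : ∀ j, κ ≤ Θ j (M + 1)) {K C : ℝ} (hK : 0 < K) (hC : 0 < C) {T : ℕ → ℝ}
    (hT : ∀ p < M, 0 ≤ T p)
    (hprod : ∀ p < M, ∏ j, (Θ j (p + 2) / (Θ j (p + 1) * ℓ j p ^ 2)) ^ wt j ≤
      K * (1 + ∑ j, Θ j (p + 2) / (Θ j (p + 1) * ℓ j p ^ 2)) ^ (M - p))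
    (hCT : ∀ p < M, 1 + ∑ j, Θ j (p + 2) / (Θ j (p + 1) * ℓ j p ^ 2) ≤ C * T p)
    {e : ℝ} (he : e = ∑ j, wt j - (M + 1)) :
    t 0 ^ e * (∏ l ∈ range (M + 1), t l) /
        ∏ j, (t 0 * Θ j 1 * ∏ p ∈ range M, ℓ j p ^ 2) ^ wt j ≤
      (κ⁻¹ ^ q * K ^ M) *
        (C * ∑ p ∈ range M, t (p + 1) / t p * T p) ^ (∑ p ∈ range M, (M - p)) := by
  have ht0 := ht 0 (Nat.zero_le _)
  have hℓ0 : ∀ j, ∀ p < M, 0 < ℓ j p := fun j p hp => by linarith [hℓ j p hp]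
  have hLpos : ∀ j, 0 < ∏ p ∈ range M, ℓ j p ^ 2 := fun j =>
    prod_pos fun p hp => pow_pos (hℓ0 j p (mem_range.1 hp)) 2
  have hΘ1 : ∀ j, 0 < Θ j 1 := fun j => hΘ j 1 le_rfl (by omega)
  have hΞ : ∀ j, ∀ p < M, 0 < Θ j (p + 2) / (Θ j (p + 1) * ℓ j p ^ 2) := fun j p hp =>
    div_pos (hΘ j _ (by omega) (by omega))
      (mul_pos (hΘ j _ (by omega) (by omega)) (pow_pos (hℓ0 j p hp) 2))
  have hden : ∏ j, (t 0 * Θ j 1 * ∏ p ∈ range M, ℓ j p ^ 2) ^ wt j =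
      t 0 ^ (∑ j, wt j) * ∏ j, (Θ j 1 * ∏ p ∈ range M, ℓ j p ^ 2) ^ wt j := by
    rw [Real.rpow_sum_of_pos ht0, ← prod_mul_distrib]
    refine prod_congr rfl fun j _ => ?_
    rw [mul_assoc, Real.mul_rpow ht0.le (mul_pos (hΘ1 j) (hLpos j)).le]
  -- The power t_0^{∑ω_j} cancels the one drawn out of the denominator; the remaining t_0^{-(M+1)}
  -- is what the product of the Ω_p needs.
  have hte : t 0 ^ e = t 0 ^ (∑ j, wt j) / t 0 ^ (M + 1) := by
    rw [he, Real.rpow_sub ht0]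
    congr 1
    exact_mod_cast Real.rpow_natCast (t 0) (M + 1)
  -- ∏_pΞ_{j,p} telescopes to Θ_{j,M+1}/(Θ_{j,1}∏ℓ²). The numerator to the power ω_j ≤ 1 is at least
  -- κ, because κ ≤ 1.
  have hfac : ∀ j, ((Θ j 1 * ∏ p ∈ range M, ℓ j p ^ 2) ^ wt j)⁻¹ ≤
      κ⁻¹ * ∏ p ∈ range M, (Θ j (p + 2) / (Θ j (p + 1) * ℓ j p ^ 2)) ^ wt j := by
    intro j
    have h1 : ∏ p ∈ range M, Θ j (p + 2) / (Θ j (p + 1) * ℓ j p ^ 2) =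
        Θ j (M + 1) * (Θ j 1 * ∏ p ∈ range M, ℓ j p ^ 2)⁻¹ := by
      have : ∀ p, Θ j (p + 2) / (Θ j (p + 1) * ℓ j p ^ 2) =
          Θ j (p + 2) / Θ j (p + 1) * (ℓ j p ^ 2)⁻¹ := fun p => by
        rw [div_mul_eq_div_div, div_eq_mul_inv (_ / _)]
      rw [prod_congr rfl fun p _ => this p, prod_mul_distrib,
        prod_ratio_eq M fun l h1 h2 => (hΘ j l h1 h2).ne', prod_inv_distrib, mul_inv,
        div_eq_mul_inv, mul_assoc]
    rw [Real.finsetProd_rpow _ _ fun p hp => (hΞ j p (mem_range.1 hp)).le, h1,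
      Real.mul_rpow (hΘ j _ (by omega) le_rfl).le (inv_pos.2 (mul_pos (hΘ1 j) (hLpos j))).le,
      Real.inv_rpow (mul_pos (hΘ1 j) (hLpos j)).le, ← mul_assoc]
    refine le_mul_of_one_le_left (by have := hΘ1 j; have := hLpos j; positivity) ?_
    rw [inv_mul_eq_div, one_le_div hκ]
    calc κ = κ ^ (1 : ℝ) := (Real.rpow_one κ).symm
      _ ≤ κ ^ wt j := Real.rpow_le_rpow_of_exponent_ge hκ hκ1 (hwt1 j)
      _ ≤ _ := Real.rpow_le_rpow hκ.le (hκΘ j) (hwt0 j).le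
  have hX : t 0 ^ e * (∏ l ∈ range (M + 1), t l) /
      ∏ j, (t 0 * Θ j 1 * ∏ p ∈ range M, ℓ j p ^ 2) ^ wt j =
      (∏ p ∈ range M, (t (p + 1) / t p) ^ (M - p)) *
        ∏ j, ((Θ j 1 * ∏ p ∈ range M, ℓ j p ^ 2) ^ wt j)⁻¹ := by
    rw [hden, hte, prod_div_pow_eq M fun l hl => (ht l hl).ne', prod_inv_distrib]
    have h1 : t 0 ^ (∑ j, wt j) ≠ 0 := (Real.rpow_pos_of_pos ht0 _).ne'
    have h2 : ∏ j, (Θ j 1 * ∏ p ∈ range M, ℓ j p ^ 2) ^ wt j ≠ 0 :=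
      prod_ne_zero_iff.2 fun j _ => (Real.rpow_pos_of_pos (mul_pos (hΘ1 j) (hLpos j)) _).ne'
    field_simp
  set Λ := ∑ p ∈ range M, t (p + 1) / t p * T p with hΛ
  have hΩ : ∀ p < M, 0 < t (p + 1) / t p := fun p hp => div_pos (ht _ hp) (ht _ hp.le)
  have hterm : ∀ p < M, t (p + 1) / t p * T p ≤ Λ := fun p hp =>
    single_le_sum (f := fun p => t (p + 1) / t p * T p)
      (fun i hi => mul_nonneg (hΩ i (mem_range.1 hi)).le (hT i (mem_range.1 hi)))
      (mem_range.2 hp)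
  have hN : ∀ p < M, 0 ≤ 1 + ∑ j, Θ j (p + 2) / (Θ j (p + 1) * ℓ j p ^ 2) := fun p hp =>
    add_nonneg zero_le_one (sum_nonneg fun j _ => (hΞ j p hp).le)
  rw [hX]
  calc (∏ p ∈ range M, (t (p + 1) / t p) ^ (M - p)) *
        ∏ j, ((Θ j 1 * ∏ p ∈ range M, ℓ j p ^ 2) ^ wt j)⁻¹
      ≤ (∏ p ∈ range M, (t (p + 1) / t p) ^ (M - p)) *
        ∏ j, (κ⁻¹ * ∏ p ∈ range M, (Θ j (p + 2) / (Θ j (p + 1) * ℓ j p ^ 2)) ^ wt j) := by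
        refine mul_le_mul_of_nonneg_left (prod_le_prod (fun j _ => ?_) fun j _ => hfac j)
          (prod_nonneg fun p hp => pow_nonneg (hΩ p (mem_range.1 hp)).le _)
        exact inv_nonneg.2 (Real.rpow_nonneg (mul_pos (hΘ1 j) (hLpos j)).le _)
    _ = κ⁻¹ ^ q * ((∏ p ∈ range M, (t (p + 1) / t p) ^ (M - p)) *
        ∏ p ∈ range M, ∏ j, (Θ j (p + 2) / (Θ j (p + 1) * ℓ j p ^ 2)) ^ wt j) := by
        rw [prod_mul_distrib, prod_const, card_univ, Fintype.card_fin, Finset.prod_comm]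
        ring
    _ ≤ κ⁻¹ ^ q * ∏ p ∈ range M, (K * (C * Λ) ^ (M - p)) := by
        rw [← prod_mul_distrib]
        refine mul_le_mul_of_nonneg_left (prod_le_prod (fun p hp => ?_) fun p hp => ?_)
          (by positivity)
        · exact mul_nonneg (pow_nonneg (hΩ p (mem_range.1 hp)).le _)
            (prod_nonneg fun j _ => Real.rpow_nonneg (hΞ j p (mem_range.1 hp)).le _)
        · have hp' := mem_range.1 hp
          calc _ ≤ (t (p + 1) / t p) ^ (M - p) *
                (K * (1 + ∑ j, Θ j (p + 2) / (Θ j (p + 1) * ℓ j p ^ 2)) ^ (M - p)) :=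
                mul_le_mul_of_nonneg_left (hprod p hp') (pow_nonneg (hΩ p hp').le _)
            _ = K * (t (p + 1) / t p *
                (1 + ∑ j, Θ j (p + 2) / (Θ j (p + 1) * ℓ j p ^ 2))) ^ (M - p) := by
                rw [mul_pow]; ring
            _ ≤ K * (C * Λ) ^ (M - p) := by
                refine mul_le_mul_of_nonneg_left (pow_le_pow_left₀
                  (mul_nonneg (hΩ p hp').le (hN p hp')) ?_ _) hK.le
                calc _ ≤ t (p + 1) / t p * (C * T p) :=
                      mul_le_mul_of_nonneg_left (hCT p hp') (hΩ p hp').le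
                  _ = C * (t (p + 1) / t p * T p) := by ring
                  _ ≤ C * Λ := mul_le_mul_of_nonneg_left (hterm p hp') hC.le
    _ = _ := by
        rw [prod_mul_distrib, prod_const, card_range, prod_pow_eq_pow_sum, mul_assoc]

end RealEstimates

end GaussMap

namespace GaussMap

open Finset Matrix Filter Topology

/-! ### The lower bound for the Levi form at a point -/

section PointwiseEstimates

variable {M q : ℕ} {g : Fin (M + 1) → ℂ → ℂ} {z : ℂ} {y : ℕ → Fin (M + 1) → ℂ} {c : ℕ → ℕ → ℂ}

theorem HasLeviData.ddc_eq {u : ℂ → ℝ} {z G : ℂ} {L : ℝ} (h : HasLeviData u z G L) :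
    ddc u z = L / Real.pi := by
  unfold ddc
  rw [h.laplacian_eq]
  field_simp

theorem ddc_norm_sq (z : ℂ) : ddc (fun w => ‖w‖ ^ 2) z = 1 / Real.pi := by
  have h := HasLeviData.norm_sq (f := fun w => w) (z := z) analyticAt_id
  rw [h.ddc_eq]
  simp

theorem normSqSum_ne_zero_of_derivedNorm (hy : IsOrthogonalSeq y)
    (h : ∀ l, jet g z l = y l + ∑ i ∈ range l, c l i • y i) {l : ℕ} (hl : derivedNorm g l z ≠ 0) :
    normSqSum (y l) ≠ 0 := by
  have h1 : derivedNorm g l z ^ 2 ≠ 0 := pow_ne_zero 2 hl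
  rw [derivedNorm_sq_frame hy h, prod_range_succ] at h1
  exact right_ne_zero_of_mul h1

theorem contactFunction_nonneg (g : Fin (M + 1) → ℂ → ℂ) (a : Fin (M + 1) → ℂ) (p : ℕ) (z : ℂ) :
    0 ≤ contactFunction g a p z :=
  div_nonneg (contactNorm_nonneg g a z) (derivedNorm_nonneg g z)

theorem contactFunction_sq_frame (hy : IsOrthogonalSeq y)
    (h : ∀ l, jet g z l = y l + ∑ i ∈ range l, c l i • y i) (a : Fin (M + 1) → ℂ) {p : ℕ}
    (hp : derivedNorm g p z ≠ 0) :
    contactFunction g a p z ^ 2 = ∑ l ∈ range (p + 1), lineContact a (y l) := by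
  have h1 : derivedNorm g p z ^ 2 ≠ 0 := pow_ne_zero 2 hp
  rw [contactFunction, div_pow, contactNorm_sq_frame hy h, div_eq_iff h1,
    derivedNorm_sq_frame hy h, mul_comm]

theorem sum_lineContact_le (a : Fin (M + 1) → ℂ) (y : ℕ → Fin (M + 1) → ℂ) {m : ℕ}
    (hm : m ≤ M + 1) : ∑ l ∈ range m, lineContact a (y l) ≤ (M + 1) * normSqSum a := by
  calc ∑ l ∈ range m, lineContact a (y l) ≤ ∑ _l ∈ range m, normSqSum a :=
        sum_le_sum fun l _ => lineContact_le _ _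
    _ = m * normSqSum a := by rw [sum_const, card_range, nsmul_eq_mul]
    _ ≤ _ := mul_le_mul_of_nonneg_right (by exact_mod_cast hm) (normSqSum_nonneg a)

theorem continuousAt_contactFunction (hg : ∀ k, AnalyticAt ℂ (g k) z) (a : Fin (M + 1) → ℂ)
    {p : ℕ} (hp : derivedNorm g p z ≠ 0) : ContinuousAt (contactFunction g a p) z := by
  have h1 : ContinuousAt (fun w => √(contactNorm g a p w ^ 2)) z :=
    (hasLeviData_contactNorm_sq (p := p) hg a).contDiffAt.continuousAt.sqrt
  have h2 : ContinuousAt (fun w => √(derivedNorm g p w ^ 2)) z :=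
    (hasLeviData_derivedNorm_sq (p := p) hg).contDiffAt.continuousAt.sqrt
  simp only [Real.sqrt_sq (contactNorm_nonneg g a _)] at h1
  simp only [Real.sqrt_sq (derivedNorm_nonneg g _)] at h2
  exact h1.div h2 hp

theorem continuousAt_derivedNorm (hg : ∀ k, AnalyticAt ℂ (g k) z) (p : ℕ) :
    ContinuousAt (derivedNorm g p) z := by
  have h2 : ContinuousAt (fun w => √(derivedNorm g p w ^ 2)) z :=
    (hasLeviData_derivedNorm_sq (p := p) hg).contDiffAt.continuousAt.sqrt
  simpa only [Real.sqrt_sq (derivedNorm_nonneg g _)] using h2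

theorem log_quotient_eventuallyEq (hg : ∀ k, AnalyticAt ℂ (g k) z) (a : Fin q → Fin (M + 1) → ℂ)
    (ε δ : ℝ) (wt : Fin q → ℝ) (hF : ∀ p < M, derivedNorm g p z ≠ 0)
    (hφ : ∀ j, ∀ p < M, contactFunction g (a j) p z ≠ 0) (hδ : 0 < δ)
    (hℓ : ∀ j, ∀ p < M, 0 < Real.log (δ / contactFunction g (a j) p z)) :
    (fun w => Real.log ((∏ p ∈ range M, derivedNorm g p w ^ (2 * ε)) /
        ∏ j, ∏ p ∈ range M, Real.log (δ / contactFunction g (a j) p w) ^ (2 * wt j))) =ᶠ[𝓝 z]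
      fun w => ∑ p ∈ range M, ε * Real.log (derivedNorm g p w ^ 2) +
        ∑ j, ∑ p ∈ range M,
          wt j * (-2 * Real.log (Real.log (δ / contactFunction g (a j) p w))) := by
  have h1 : ∀ᶠ w in 𝓝 z, ∀ p ∈ range M, derivedNorm g p w ≠ 0 :=
    (eventually_all_finset _).2 fun p hp =>
      (continuousAt_derivedNorm hg p).eventually_ne (hF p (mem_range.1 hp))
  have h2 : ∀ᶠ w in 𝓝 z, ∀ j, ∀ p ∈ range M,
      0 < Real.log (δ / contactFunction g (a j) p w) := by
    refine eventually_all.2 fun j => (eventually_all_finset _).2 fun p hp => ?_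
    have hp' := mem_range.1 hp
    have hc : ContinuousAt (fun w => Real.log (δ / contactFunction g (a j) p w)) z :=
      (continuousAt_const.div (continuousAt_contactFunction hg (a j) (hF p hp'))
        (hφ j p hp')).log (div_ne_zero hδ.ne' (hφ j p hp'))
    exact hc.eventually (lt_mem_nhds (hℓ j p hp'))
  filter_upwards [h1, h2] with w hw1 hw2
  have hpos : ∀ p ∈ range M, 0 < derivedNorm g p w := fun p hp =>
    lt_of_le_of_ne (derivedNorm_nonneg g w) (hw1 p hp).symm
  rw [Real.log_div
      (prod_ne_zero_iff.2 fun p hp => (Real.rpow_pos_of_pos (hpos p hp) _).ne')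
      (prod_ne_zero_iff.2 fun j _ => prod_ne_zero_iff.2 fun p hp =>
        (Real.rpow_pos_of_pos (hw2 j p hp) _).ne'),
    Real.log_prod fun p hp => (Real.rpow_pos_of_pos (hpos p hp) _).ne',
    Real.log_prod fun j _ => prod_ne_zero_iff.2 fun p hp =>
        (Real.rpow_pos_of_pos (hw2 j p hp) _).ne', sub_eq_add_neg, ← sum_neg_distrib]
  congr 1
  · refine sum_congr rfl fun p hp => ?_
    rw [Real.log_rpow (hpos p hp), Real.log_pow]
    push_cast
    ring
  · refine sum_congr rfl fun j _ => ?_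
    rw [Real.log_prod fun p hp => (Real.rpow_pos_of_pos (hw2 j p hp) _).ne', ← sum_neg_distrib]
    refine sum_congr rfl fun p hp => ?_
    rw [Real.log_rpow (hw2 j p hp)]
    ring

/-- The lower bound for the Levi form, with the terms of order `1 / ℓ` absorbed. -/
theorem ddc_log_quotient_ge (hg : ∀ k, AnalyticAt ℂ (g k) z) (hy : IsOrthogonalSeq y)
    (h : ∀ l, jet g z l = y l + ∑ i ∈ range l, c l i • y i) (a : Fin q → Fin (M + 1) → ℂ)
    {ε δ : ℝ} (hε : 0 < ε) (hδ : 0 < δ) {wt : Fin q → ℝ} (hwt0 : ∀ j, 0 < wt j)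
    (hwt1 : ∀ j, wt j ≤ 1) (hF : ∀ p < M, derivedNorm g p z ≠ 0)
    (hφ : ∀ j, ∀ p < M, contactFunction g (a j) p z ≠ 0)
    (hℓ : ∀ j, ∀ p < M, 1 + 3 * q / ε ≤ Real.log (δ / contactFunction g (a j) p z)) :
    (∑ p ∈ range M, normSqSum (y (p + 1)) / normSqSum (y p) *
      (ε / 2 + 1 / 2 * ∑ j, wt j * ((∑ l ∈ range (p + 2), lineContact (a j) (y l)) /
        ((∑ l ∈ range (p + 1), lineContact (a j) (y l)) *
          Real.log (δ / contactFunction g (a j) p z) ^ 2)))) / Real.pi ≤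
    ddc (fun w => Real.log ((∏ p ∈ range M, derivedNorm g p w ^ (2 * ε)) /
        ∏ j, ∏ p ∈ range M, Real.log (δ / contactFunction g (a j) p w) ^ (2 * wt j))) z := by
  have h1ℓ : ∀ j, ∀ p < M, 1 ≤ Real.log (δ / contactFunction g (a j) p z) := fun j p hp => by
    have : 0 ≤ 3 * q / ε := by positivity
    linarith [hℓ j p hp]
  have h0 : ∀ p < M, ∀ l ≤ p, normSqSum (y l) ≠ 0 := fun p hp l hl =>
    normSqSum_ne_zero_of_derivedNorm hy h (hF l (by omega))
  have hΘ : ∀ j, ∀ p < M, ∑ l ∈ range (p + 1), lineContact (a j) (y l) ≠ 0 := fun j p hp => by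
    rw [← contactFunction_sq_frame hy h (a j) (hF p hp)]
    exact pow_ne_zero 2 (hφ j p hp)
  have hΘpos : ∀ j, ∀ p < M, 0 < ∑ l ∈ range (p + 1), lineContact (a j) (y l) := fun j p hp =>
    lt_of_le_of_ne (sum_nonneg fun _ _ => lineContact_nonneg _ _) (hΘ j p hp).symm
  let L1 : ℕ → ℝ := fun p => normSqSum (y (p + 1)) / normSqSum (y p)
  let Br : Fin q → ℕ → ℝ := fun j p =>
    ((∑ l ∈ range p, lineContact (a j) (y l)) * (∑ l ∈ range (p + 2), lineContact (a j) (y l)) /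
      (∑ l ∈ range (p + 1), lineContact (a j) (y l)) ^ 2 - 1) /
        Real.log (δ / contactFunction g (a j) p z) +
      lineContact (a j) (y p) * lineContact (a j) (y (p + 1)) /
        (∑ l ∈ range (p + 1), lineContact (a j) (y l)) ^ 2 /
          (2 * Real.log (δ / contactFunction g (a j) p z) ^ 2)
  -- The membership is placed under the existential so that `choose` yields gradients defined for
  -- all p.
  have hA : ∀ p, ∃ G, p ∈ range M →
      HasLeviData (fun w => Real.log (derivedNorm g p w ^ 2)) z G (L1 p) := fun p => by
    by_cases hp : p ∈ range M
    · obtain ⟨G, hG⟩ := exists_hasLeviData_log_derivedNorm_sq hg hy h (h0 p (mem_range.1 hp))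
      exact ⟨G, fun _ => hG⟩
    · exact ⟨0, fun h => absurd h hp⟩
  have hB : ∀ j p, ∃ G, p ∈ range M →
      HasLeviData (fun w => -2 * Real.log (Real.log (δ / contactFunction g (a j) p w))) z G
        (L1 p * Br j p) := fun j p => by
    by_cases hp : p ∈ range M
    · have hp' := mem_range.1 hp
      obtain ⟨G, hG⟩ := exists_hasLeviData_neg_log_log hg hy h (h0 p hp') (a j) (hΘ j p hp') hδ
        (by linarith [h1ℓ j p hp'])
      exact ⟨G, fun _ => hG⟩
    · exact ⟨0, fun h => absurd h hp⟩
  choose GA hGA using hA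
  choose GB hGB using hB
  have hL := ((HasLeviData.sum (range M) fun p hp => (hGA p hp).const_mul ε).add
    (HasLeviData.sum univ fun j _ => HasLeviData.sum (range M) fun p hp =>
      (hGB j p hp).const_mul (wt j))).congr
    (log_quotient_eventuallyEq hg a ε δ wt hF hφ hδ fun j p hp => by linarith [h1ℓ j p hp])
  rw [hL.ddc_eq]
  refine div_le_div_of_nonneg_right ?_ Real.pi_pos.le
  rw [Finset.sum_comm (s := univ), ← sum_add_distrib]
  refine sum_le_sum fun p hp => ?_
  have hp' := mem_range.1 hp
  have hL1 : 0 ≤ L1 p := div_nonneg (normSqSum_nonneg _) (normSqSum_nonneg _)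
  -- Since ℓ ≥ 3q/ε and ω_j ≤ 1, each j loses at most ε/(2q). The q losses together use half of the
  -- available ε.
  have hbr : ∀ j, wt j * (1 / 2 * ((∑ l ∈ range (p + 2), lineContact (a j) (y l)) /
      ((∑ l ∈ range (p + 1), lineContact (a j) (y l)) *
        Real.log (δ / contactFunction g (a j) p z) ^ 2))) - ε / (2 * (q : ℝ)) ≤ wt j * Br j p := by
    intro j
    have hq0 : (0 : ℝ) < q := by exact_mod_cast j.pos
    have h1 := levi_bracket_ge (x := ∑ l ∈ range p, lineContact (a j) (y l))
      (v := lineContact (a j) (y p)) (w := lineContact (a j) (y (p + 1)))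
      (sum_nonneg fun _ _ => lineContact_nonneg _ _) (lineContact_nonneg _ _)
      (by rw [← sum_range_succ]; exact hΘpos j p hp') (h1ℓ j p hp')
    rw [← sum_range_succ, ← sum_range_succ] at h1
    have h2 := mul_le_mul_of_nonneg_left h1 (hwt0 j).le
    have h3 : wt j * (3 / (2 * Real.log (δ / contactFunction g (a j) p z))) ≤ ε / (2 * q) := by
      have hl := hℓ j p hp'
      have hl1 := h1ℓ j p hp'
      have h4 : 3 / (2 * Real.log (δ / contactFunction g (a j) p z)) ≤ ε / (2 * q) := by
        rw [div_le_div_iff₀ (by linarith) (by linarith)]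
        have h5 : 3 * q / ε ≤ Real.log (δ / contactFunction g (a j) p z) := by linarith
        rw [div_le_iff₀ hε] at h5
        linarith
      calc _ ≤ 1 * (3 / (2 * Real.log (δ / contactFunction g (a j) p z))) :=
            mul_le_mul_of_nonneg_right (hwt1 j) (div_nonneg (by norm_num) (by linarith))
        _ ≤ _ := by rw [one_mul]; exact h4
    rw [mul_sub] at h2
    exact (sub_le_sub_left h3 _).trans h2
  have hsum := sum_le_sum fun j (_ : j ∈ univ) => hbr j
  rw [sum_sub_distrib, sum_const, card_univ, Fintype.card_fin, nsmul_eq_mul] at hsum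
  have hqε : (q : ℝ) * (ε / (2 * q)) ≤ ε / 2 := by
    rcases eq_or_ne (q : ℝ) 0 with h | h
    · rw [h]; simp; positivity
    · apply le_of_eq; field_simp
  have hfin : ε / 2 + 1 / 2 * ∑ j, wt j * ((∑ l ∈ range (p + 2), lineContact (a j) (y l)) /
        ((∑ l ∈ range (p + 1), lineContact (a j) (y l)) *
          Real.log (δ / contactFunction g (a j) p z) ^ 2)) ≤ ε + ∑ j, wt j * Br j p := by
    have : 1 / 2 * ∑ j, wt j * ((∑ l ∈ range (p + 2), lineContact (a j) (y l)) /
        ((∑ l ∈ range (p + 1), lineContact (a j) (y l)) *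
          Real.log (δ / contactFunction g (a j) p z) ^ 2)) =
        ∑ j, wt j * (1 / 2 * ((∑ l ∈ range (p + 2), lineContact (a j) (y l)) /
      ((∑ l ∈ range (p + 1), lineContact (a j) (y l)) *
        Real.log (δ / contactFunction g (a j) p z) ^ 2))) := by
      rw [mul_sum]
      exact sum_congr rfl fun j _ => by ring
    rw [this]
    linarith
  calc _ ≤ L1 p * (ε + ∑ j, wt j * Br j p) := mul_le_mul_of_nonneg_left hfin hL1
    _ = _ := by
      rw [mul_add, mul_sum, mul_comm]
      congr 1
      exact sum_congr rfl fun j _ => by ring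

end PointwiseEstimates

end GaussMap

namespace GaussMap

open Finset Matrix Filter Topology

/-! ### Constants independent of the curve -/

section Constants

variable {n d k N q M : ℕ} {V : Set (PSpace n)} {v : Fin (M + 1) → Forms n d}
  {𝒱 : Module.Basis (Fin (M + 1)) ℂ (FormClasses V d)} {Q : Fin q → Forms n d} {wt : Fin q → ℝ}

/-- As k ≤ M, the bound on q gives q > 2N-k+1, and this is at least N+1 because k ≤ N. -/
theorem succ_le_of_subgeneral_bound (hkN : k ≤ N) (hkM : k ≤ M)
    (hq : (2 * (N : ℝ) - k + 1) * (M + 1) / (k + 1) < q) : N + 1 ≤ q := by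
  have hk0 : (0 : ℝ) < k + 1 := by positivity
  have h1 : (k : ℝ) ≤ N := by exact_mod_cast hkN
  have h2 : (k : ℝ) ≤ M := by exact_mod_cast hkM
  rw [div_lt_iff₀ hk0] at hq
  have h3 : (2 * (N : ℝ) - k + 1) * (k + 1) ≤ (2 * (N : ℝ) - k + 1) * (M + 1) :=
    mul_le_mul_of_nonneg_left (by linarith) (by linarith)
  have h4 : 2 * (N : ℝ) - k + 1 < q := lt_of_mul_lt_mul_right (h3.trans_lt hq) hk0.le
  have h5 : (N : ℝ) < q := by linarith
  exact_mod_cast h5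

theorem linearIndependent_repr {T : Finset (Fin q)}
    (hT : LinearIndependent ℂ (fun j : T => formClass V (Q j))) :
    LinearIndependent ℂ (fun (j : T) (l : Fin (M + 1)) => 𝒱.repr (formClass V (Q j)) l) :=
  hT.map' 𝒱.equivFun.toLinearMap (LinearMap.ker_eq_bot.2 𝒱.equivFun.injective)

theorem analyticAt_liftedCurve (v : Fin (M + 1) → Forms n d) {F : ℂ → Fin (n + 1) → ℂ}
    {U : Set ℂ} (hU : IsOpen U) (hF : DifferentiableOn ℂ F U) {z : ℂ} (hz : z ∈ U)
    (i : Fin (M + 1)) : AnalyticAt ℂ (liftedCurve v F i) z := by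
  have h : ∀ r, AnalyticAt ℂ (fun w => F w r) z := fun r =>
    (differentiableOn_pi.1 hF r).analyticAt (hU.mem_nhds hz)
  have := AnalyticAt.aeval_mvPolynomial h (v i).1
  simp only [MvPolynomial.aeval_eq_eval] at this
  exact this

/-- The bound for `∏_j (φ_{p+1}² / (φ_p² log² (δ / φ_p))) ^ ω_j` at a point of the curve. -/
theorem IsNochkaWeights.exists_prod_ratio_le (hV : IsProjectiveAlgebraic V)
    (hv : ∀ i, 𝒱 i = formClass V (v i)) (hpos : InSubgeneralPosition V N Q) (hNq : N + 1 ≤ q)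
    (hwt : IsNochkaWeights V k N Q wt) :
    ∃ K > 0, ∀ (X : Fin (n + 1) → ℂ) (hX : X ≠ 0), Projectivization.mk ℂ X hX ∈ V →
      ∀ y : ℕ → Fin (M + 1) → ℂ, (y 0 = fun i => MvPolynomial.eval X (v i).1) →
      IsOrthogonalSeq y → (∀ l ≤ M, normSqSum (y l) ≠ 0) →
      (∀ j, ∀ p < M, ∑ l ∈ range (p + 1),
        lineContact (fun l => 𝒱.repr (formClass V (Q j)) l) (y l) ≠ 0) →
      ∀ ℓ : Fin q → ℕ → ℝ, (∀ j, ∀ p < M, 1 ≤ ℓ j p) → ∀ p < M,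
      ∏ j, ((∑ l ∈ range (p + 2), lineContact (fun l => 𝒱.repr (formClass V (Q j)) l) (y l)) /
        ((∑ l ∈ range (p + 1), lineContact (fun l => 𝒱.repr (formClass V (Q j)) l) (y l)) *
          ℓ j p ^ 2)) ^ wt j ≤
      K * (1 + ∑ j, (∑ l ∈ range (p + 2),
          lineContact (fun l => 𝒱.repr (formClass V (Q j)) l) (y l)) /
        ((∑ l ∈ range (p + 1), lineContact (fun l => 𝒱.repr (formClass V (Q j)) l) (y l)) *
          ℓ j p ^ 2)) ^ (M - p) := by
  set a : Fin q → Fin (M + 1) → ℂ := fun j l => 𝒱.repr (formClass V (Q j)) l with ha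
  obtain ⟨c, hc, hcV⟩ := hpos.exists_forall_exists_le hV v
  obtain ⟨κ, hκ, hκT⟩ := exists_forall_exists_le_sum_lineContact a
  set A := ∑ j, ((M : ℝ) + 1) * normSqSum (a j) with hA
  have hA0 : ∀ j ∈ univ, 0 ≤ ((M : ℝ) + 1) * normSqSum (a j) := fun j _ =>
    mul_nonneg (by positivity) (normSqSum_nonneg _)
  have hAnn : 0 ≤ A := sum_nonneg hA0
  -- A bounds every φ_{p+1}², so Ξ_j ≤ B as soon as φ_p(Q_j)² ≥ min(c, κ).
  set B := A / min c κ with hB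
  have hB0 : 0 ≤ B := div_nonneg hAnn (lt_min hc hκ).le
  refine ⟨(1 + B) ^ (2 * q), by positivity, fun X hX hXV y hy0 hy ht hΘ ℓ hℓ p hp => ?_⟩
  have hΘnn : ∀ j m, 0 ≤ ∑ l ∈ range m, lineContact (a j) (y l) := fun j m =>
    sum_nonneg fun _ _ => lineContact_nonneg _ _
  have hle : ∀ j, min c κ ≤ ∑ l ∈ range (p + 1), lineContact (a j) (y l) →
      (∑ l ∈ range (p + 2), lineContact (a j) (y l)) /
        ((∑ l ∈ range (p + 1), lineContact (a j) (y l)) * ℓ j p ^ 2) ≤ B := by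
    intro j hj
    have h1 : ∑ l ∈ range (p + 2), lineContact (a j) (y l) ≤ A :=
      (sum_lineContact_le (a j) y (by omega)).trans (single_le_sum hA0 (mem_univ j))
    have hℓ1 := hℓ j p hp
    refine div_le_div₀ hAnn h1 (lt_min hc hκ) ?_
    calc min c κ ≤ (∑ l ∈ range (p + 1), lineContact (a j) (y l)) * 1 := by rwa [mul_one]
      _ ≤ _ := mul_le_mul_of_nonneg_left (by nlinarith) (hΘnn _ _)
  refine hwt.prod_rpow_le hNq (fun j => ?_) hB0 (fun R hR => ?_) (fun T hT hTc => ?_)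
  · exact div_nonneg (hΘnn _ _) (mul_nonneg (hΘnn _ _) (sq_nonneg _))
  -- φ_p² ≥ φ_0² = |Q_j(F)|²/|F_0|², which subgeneral position bounds below for some j in R.
  · obtain ⟨j, hj, hjc⟩ := hcV X hX hXV R hR
    refine ⟨j, hj, hle j ((min_le_left _ _).trans ?_)⟩
    have h1 : c ≤ lineContact (a j) (y 0) := by
      have ht0 : 0 < normSqSum (y 0) :=
        lt_of_le_of_ne (normSqSum_nonneg _) (ht 0 (Nat.zero_le _)).symm
      rw [lineContact, le_div_iff₀ ht0]
      have h2 : y 0 ⬝ᵥ a j = MvPolynomial.eval X (Q j).1 := by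
        rw [eval_eq_sum_repr hv (Q j) hX hXV, hy0]
        exact sum_congr rfl fun l _ => mul_comm _ _
      rw [h2]
      simpa [normSqSum, hy0] using hjc
    exact h1.trans (single_le_sum (f := fun l => lineContact (a j) (y l))
      (fun l _ => lineContact_nonneg _ _) (mem_range.2 (Nat.succ_pos p)))
  -- There are M-p+1 functionals and p+1 vectors in dimension M+1: one too many.
  · obtain ⟨j, hj, hjκ⟩ := hκT T (linearIndependent_repr hT) y (p + 1) hy
      (fun l hl => ht l (by omega)) (by omega)
    exact ⟨j, hj, hle j ((min_le_right _ _).trans hjκ)⟩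

end Constants

theorem rpow_two_mul_eq {r : ℝ} (hr : 0 ≤ r) (e : ℝ) : r ^ (2 * e) = (r ^ 2) ^ e := by
  rw [Real.rpow_mul hr, Real.rpow_two]

theorem inv_mul_rpow_le {M : ℕ} (hM : 1 ≤ M) {X C₁ C₂ Λ : ℝ} (hX : 0 ≤ X) (hC₁ : 0 < C₁)
    (hC₂ : 0 < C₂) (hΛ : 0 ≤ Λ) (h : X ≤ C₂ * (C₁ * Λ) ^ (∑ p ∈ range M, (M - p))) :
    (C₂ ^ (2 / ((M : ℝ) * (M + 1))) * C₁)⁻¹ * X ^ (2 / ((M : ℝ) * (M + 1))) ≤ Λ := by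
  have hM0 : (0 : ℝ) < M := by exact_mod_cast hM
  have hs : ((∑ p ∈ range M, (M - p) : ℕ) : ℝ) * (2 / ((M : ℝ) * (M + 1))) = 1 := by
    have h2 : (2 : ℝ) * ((∑ p ∈ range M, (M - p) : ℕ) : ℝ) = M * (M + 1) := by
      exact_mod_cast two_mul_sum_sub M
    rw [← mul_div_assoc, mul_comm, h2, div_self (by positivity)]
  have h1 := Real.rpow_le_rpow hX h (z := 2 / ((M : ℝ) * (M + 1))) (by positivity)
  rw [Real.mul_rpow hC₂.le (by positivity), ← Real.rpow_natCast_mul (by positivity), hs,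
    Real.rpow_one, ← mul_assoc] at h1
  rw [inv_mul_le_iff₀ (by positivity)]
  exact h1

end GaussMap

end

/-! ### Choice of constants and conclusion -/

theorem theorem3p3
    {n d k N q M : ℕ} (hd : 1 ≤ d) (hk : 1 ≤ k) (hkN : k ≤ N)
    (V : Set (GaussMap.PSpace n)) (hV : GaussMap.IsProjectiveAlgebraic V)
    (hVk : GaussMap.HasDimension V k)
    -- an ordered basis `𝒱 = ([v₀], …, [v_M])` of `I_d(V)`, so `M = H_V(d) - 1`
    (v : Fin (M + 1) → GaussMap.Forms n d)
    (𝒱 : Module.Basis (Fin (M + 1)) ℂ (GaussMap.FormClasses V d))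
    (hv : ∀ i, 𝒱 i = GaussMap.formClass V (v i))
    (Q : Fin q → GaussMap.Forms n d) (hQ : ∀ j, Q j ≠ 0)
    (hpos : GaussMap.InSubgeneralPosition V N Q)
    (hq : (2 * (N : ℝ) - k + 1) * (M + 1) / (k + 1) < q)
    -- the Nochka weights `ω_j`
    (wt : Fin q → ℝ) (hwt : GaussMap.IsNochkaWeights V k N Q wt)
    (ε : ℝ) (hε : 0 < ε) :
    ∃ δ C : ℝ, 1 < δ ∧ 0 < C ∧
      ∀ (S : Type u) [TopologicalSpace S] [T2Space S] [ConnectedSpace S] [ChartedSpace ℂ S]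
        [IsManifold 𝓘(ℂ) ω S]
        (f : S → GaussMap.PSpace n), GaussMap.IsHolomorphicCurve f → (∀ s, f s ∈ V) →
        GaussMap.IsNondegenerateOver f V d →
      ∀ e ∈ IsManifold.maximalAtlas 𝓘(ℂ) ω S,
      ∀ F : ℂ → Fin (n + 1) → ℂ, GaussMap.IsReducedRepresentation f e F →
        -- `Fp p = |F_{𝒱,p}|`, `FQ j p = |F_{𝒱,p}(Q_j)|`, `φ j p = φ_{𝒱,p}(Q_j)`
        let g := GaussMap.liftedCurve v F
        let a : Fin q → Fin (M + 1) → ℂ := fun j => 𝒱.repr (GaussMap.formClass V (Q j))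
        let Fp : ℕ → ℂ → ℝ := fun p => GaussMap.derivedNorm g p
        let FQ : Fin q → ℕ → ℂ → ℝ := fun j p => GaussMap.contactNorm g (a j) p
        let φ : Fin q → ℕ → ℂ → ℝ := fun j p => GaussMap.contactFunction g (a j) p
        ∀ z ∈ e.target,
          (∀ p < M, Fp p z ≠ 0) → (∀ j, ∀ p < M, FQ j p z ≠ 0) →
          (∀ j, ∀ p < M, φ j p z < δ) ∧
          C * (Fp 0 z ^ (2 * (GaussMap.nochkaConstant wt * (q - (2 * N - k + 1)) - M + k))
                * Fp M z ^ 2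
              / ∏ j, (FQ j 0 z ^ 2 * ∏ p ∈ Finset.range M, Real.log (δ / φ j p z) ^ 2) ^ wt j)
              ^ (2 / ((M : ℝ) * (M + 1)))
            * GaussMap.ddc (fun w => ‖w‖ ^ 2) z
          ≤ GaussMap.ddc (fun w => Real.log
              ((∏ p ∈ Finset.range M, Fp p w ^ (2 * ε))
                / ∏ j, ∏ p ∈ Finset.range M, Real.log (δ / φ j p w) ^ (2 * wt j))) z := by
  open GaussMap Finset in
  have hkM : k ≤ M := hVk.le_of_basis hd hv
  have hM : 1 ≤ M := hk.trans hkM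
  have hNq : N + 1 ≤ q := succ_le_of_subgeneral_bound hkN hkM hq
  have : Nonempty (Fin q) := ⟨⟨0, by omega⟩⟩
  let b : Fin q → Fin (M + 1) → ℂ := fun j l => 𝒱.repr (formClass V (Q j)) l
  obtain ⟨K, hK, hKprod⟩ := hwt.exists_prod_ratio_le hV hv hpos hNq
  obtain ⟨κ₀, hκ₀, hκT⟩ := exists_forall_exists_le_sum_lineContact b
  obtain ⟨j₀, hj₀⟩ := Finite.exists_min wt
  have hω := hwt.pos j₀
  set κ := min κ₀ 1
  have hκ : 0 < κ := lt_min hκ₀ one_pos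
  -- A bounds all φ². The summand 1 gives A ≥ 1, so A bounds φ as well, and δ = A e^{ℓ₀} forces
  -- log(δ/φ) ≥ ℓ₀.
  set A : ℝ := 1 + ∑ j, ((M : ℝ) + 1) * normSqSum (b j) with hA
  have hA0 : ∀ j ∈ (univ : Finset (Fin q)), 0 ≤ ((M : ℝ) + 1) * normSqSum (b j) := fun j _ =>
    mul_nonneg (by positivity) (normSqSum_nonneg _)
  have hA1 : 1 ≤ A := by linarith [sum_nonneg hA0]
  set ℓ₀ : ℝ := 1 + 3 * q / ε with hℓ₀
  have hℓ₀1 : 1 ≤ ℓ₀ := by have : 0 ≤ 3 * q / ε := by positivity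
                           linarith
  -- The 2/ε recovers the 1 and the 2/ω_{j₀}, with ω_{j₀} the least weight, recovers ∑Ξ_j in 1 +
  -- ∑Ξ_j ≤ C₁ T_p.
  set C₁ : ℝ := 2 / ε + 2 / wt j₀ with hC₁
  have hC₁pos : 0 < C₁ := by positivity
  set C₂ : ℝ := κ⁻¹ ^ q * K ^ M with hC₂
  have hC₂pos : 0 < C₂ := by positivity
  set s : ℝ := 2 / ((M : ℝ) * (M + 1)) with hs
  have hMpos : (0 : ℝ) < M := by exact_mod_cast hM
  have hspos : 0 < s := by positivity
  refine ⟨A * Real.exp ℓ₀, (C₂ ^ s * C₁)⁻¹, ?_, by positivity, ?_⟩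
  · have := Real.one_lt_exp_iff.2 (by linarith : 0 < ℓ₀)
    nlinarith
  intro S _ _ _ _ _ f _ hfV _ e _ F hF g a Fp FQ φ z hz hFp hFQ
  set δ := A * Real.exp ℓ₀ with hδdef
  have hδ : 0 < δ := by positivity
  have hg : ∀ i, AnalyticAt ℂ (g i) z := fun i =>
    analyticAt_liftedCurve v e.open_target hF.holomorphic hz i
  obtain ⟨hX, hfX⟩ := hF.represents z hz
  have hXV : Projectivization.mk ℂ (F z) hX ∈ V := hfX ▸ hfV _
  obtain ⟨y, c, hy, hyx⟩ := exists_orthogonal_triangular (jet g z)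
  have hy0 : y 0 = fun i => MvPolynomial.eval (F z) (v i).1 := by
    have := hyx 0
    simp only [range_zero, sum_empty, add_zero] at this
    rw [← this]
    ext i
    simp [jet, g, liftedCurve]
  have ht : ∀ l < M, normSqSum (y l) ≠ 0 := fun l hl =>
    normSqSum_ne_zero_of_derivedNorm hy hyx (hFp l hl)
  have hφsq : ∀ j, ∀ p < M, φ j p z ^ 2 = ∑ l ∈ range (p + 1), lineContact (b j) (y l) :=
    fun j p hp => contactFunction_sq_frame hy hyx (b j) (hFp p hp)
  have hφ0 : ∀ j, ∀ p < M, φ j p z ≠ 0 := fun j p hp => div_ne_zero (hFQ j p hp) (hFp p hp)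
  have hφpos : ∀ j, ∀ p < M, 0 < φ j p z := fun j p hp =>
    lt_of_le_of_ne (contactFunction_nonneg _ _ _ _) (hφ0 j p hp).symm
  have hφA : ∀ j, ∀ p < M, φ j p z ≤ A := fun j p hp => by
    have h1 : φ j p z ^ 2 ≤ A := by
      rw [hφsq j p hp]
      have := sum_lineContact_le (b j) y (m := p + 1) (by omega)
      have := single_le_sum hA0 (mem_univ j)
      linarith
    nlinarith [hφpos j p hp]
  have hℓ : ∀ j, ∀ p < M, ℓ₀ ≤ Real.log (δ / φ j p z) := fun j p hp => by
    rw [Real.le_log_iff_exp_le (div_pos hδ (hφpos j p hp)), le_div_iff₀ (hφpos j p hp), hδdef,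
      mul_comm]
    exact mul_le_mul_of_nonneg_right (hφA j p hp) (Real.exp_pos _).le
  refine ⟨fun j p hp => ?_, ?_⟩
  · have := Real.one_lt_exp_iff.2 (by linarith : 0 < ℓ₀)
    have := hφA j p hp
    nlinarith
  have hlower := ddc_log_quotient_ge hg hy hyx b hε hδ hwt.pos hwt.le_one hFp hφ0 hℓ
  refine le_trans ?_ hlower
  rw [ddc_norm_sq, mul_one_div]
  refine div_le_div_of_nonneg_right ?_ Real.pi_pos.le
  set T : ℕ → ℝ := fun p => ε / 2 + 1 / 2 * ∑ j, wt j *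
    ((∑ l ∈ range (p + 2), lineContact (b j) (y l)) /
      ((∑ l ∈ range (p + 1), lineContact (b j) (y l)) * Real.log (δ / φ j p z) ^ 2)) with hT
  have hΘnn : ∀ j m, 0 ≤ ∑ l ∈ range m, lineContact (b j) (y l) := fun j m =>
    sum_nonneg fun _ _ => lineContact_nonneg _ _
  have hΞnn : ∀ j p, 0 ≤ (∑ l ∈ range (p + 2), lineContact (b j) (y l)) /
      ((∑ l ∈ range (p + 1), lineContact (b j) (y l)) * Real.log (δ / φ j p z) ^ 2) := fun j p =>
    div_nonneg (hΘnn _ _) (mul_nonneg (hΘnn _ _) (sq_nonneg _))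
  have hTnn : ∀ p, 0 ≤ T p := fun p => by
    have := sum_nonneg fun j (_ : j ∈ univ) => mul_nonneg (hwt.pos j).le (hΞnn j p)
    simp only [hT]
    positivity
  have hΛnn : 0 ≤ ∑ p ∈ range M, normSqSum (y (p + 1)) / normSqSum (y p) * T p :=
    sum_nonneg fun p _ => mul_nonneg (div_nonneg (normSqSum_nonneg _) (normSqSum_nonneg _)) (hTnn p)
  change (C₂ ^ s * C₁)⁻¹ * _ ^ s ≤ ∑ p ∈ range M, normSqSum (y (p + 1)) / normSqSum (y p) * T p
  have hFM : Fp M z ^ 2 = ∏ l ∈ range (M + 1), normSqSum (y l) := derivedNorm_sq_frame hy hyx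
  -- F_M may vanish at the point; the left side is then 0 and the lower bound is nonnegative.
  by_cases htM : normSqSum (y M) = 0
  · rw [hFM, prod_range_succ, htM, mul_zero, mul_zero, zero_div, Real.zero_rpow hspos.ne', mul_zero]
    exact hΛnn
  have htle : ∀ l ≤ M, normSqSum (y l) ≠ 0 := fun l hl => by
    rcases hl.lt_or_eq with h | rfl
    · exact ht l h
    · exact htM
  have hF0 : Fp 0 z ^ 2 = normSqSum (y 0) := by
    have := derivedNorm_sq_frame (p := 0) hy hyx
    simpa using this
  have hFQ0 : ∀ j, FQ j 0 z ^ 2 = normSqSum (y 0) * ∑ l ∈ range 1, lineContact (b j) (y l) := by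
    intro j
    have := contactNorm_sq_frame (p := 0) hy hyx (b j)
    simpa using this
  have hΘ0 : ∀ j, ∀ p < M, ∑ l ∈ range (p + 1), lineContact (b j) (y l) ≠ 0 := fun j p hp => by
    rw [← hφsq j p hp]
    exact pow_ne_zero 2 (hφ0 j p hp)
  -- Now y_0, …, y_M span the whole space, and the single functional a_j ≠ 0 is not small on it: the
  -- independence estimate for a one-element set.
  have hκΘ : ∀ j, κ ≤ ∑ l ∈ range (M + 1), lineContact (b j) (y l) := by
    intro j
    have hbj : b j ≠ 0 := by
      intro h
      apply hΘ0 j 0 hM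
      simp [h, lineContact]
    have hind : LinearIndependent ℂ (fun i : ({j} : Finset (Fin q)) => b i) := by
      have : Unique ({j} : Finset (Fin q)) := inferInstance
      refine LinearIndependent.of_subsingleton (⟨j, mem_singleton_self j⟩ : ({j} : Finset _)) hbj
    obtain ⟨i, hi, hle⟩ := hκT {j} hind y (M + 1) hy (fun l hl => htle l (by omega)) (by simp)
    rw [mem_singleton.1 hi] at hle
    exact (min_le_left _ _).trans hle
  have hprod := hKprod (F z) hX hXV y hy0 hy htle hΘ0 (fun j p => Real.log (δ / φ j p z))
    (fun j p hp => hℓ₀1.trans (hℓ j p hp))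
  have hCT : ∀ p < M, 1 + ∑ j, (∑ l ∈ range (p + 2), lineContact (b j) (y l)) /
      ((∑ l ∈ range (p + 1), lineContact (b j) (y l)) * Real.log (δ / φ j p z) ^ 2) ≤
        C₁ * T p := by
    intro p _
    set Ξ : Fin q → ℝ := fun j => (∑ l ∈ range (p + 2), lineContact (b j) (y l)) /
      ((∑ l ∈ range (p + 1), lineContact (b j) (y l)) * Real.log (δ / φ j p z) ^ 2)
    have h1 : wt j₀ * ∑ j, Ξ j ≤ ∑ j, wt j * Ξ j := by
      rw [mul_sum]
      exact sum_le_sum fun j _ => mul_le_mul_of_nonneg_right (hj₀ j) (hΞnn j p)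
    have h2 : 0 ≤ ∑ j, wt j * Ξ j := sum_nonneg fun j _ => mul_nonneg (hwt.pos j).le (hΞnn j p)
    have h3 : C₁ * T p = 1 + (∑ j, wt j * Ξ j) / wt j₀ + (∑ j, wt j * Ξ j) / ε + ε / wt j₀ := by
      simp only [hT, hC₁, Ξ]
      field_simp
      ring
    have h4 : ∑ j, Ξ j ≤ (∑ j, wt j * Ξ j) / wt j₀ := by
      rw [le_div_iff₀ hω, mul_comm]; exact h1
    have h5 : 0 ≤ (∑ j, wt j * Ξ j) / ε := div_nonneg h2 hε.le
    have h6 : 0 ≤ ε / wt j₀ := by positivity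
    rw [h3]
    linarith
  have hΘpos : ∀ j l, 1 ≤ l → l ≤ M + 1 → 0 < ∑ i ∈ range l, lineContact (b j) (y i) := by
    intro j l h1 h2
    rcases h2.lt_or_eq with h | rfl
    · obtain ⟨p, rfl⟩ := Nat.exists_eq_add_of_le' h1
      exact lt_of_le_of_ne (hΘnn _ _) (hΘ0 j p (by omega)).symm
    · exact hκ.trans_le (hκΘ j)
  have hXle := weighted_quotient_le (t := fun l => normSqSum (y l))
    (Θ := fun j m => ∑ l ∈ range m, lineContact (b j) (y l))
    (ℓ := fun j p => Real.log (δ / φ j p z)) (T := T) (C := C₁) (K := K) (κ := κ)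
    (e := nochkaConstant wt * (q - (2 * N - k + 1)) - M + k)
    (fun l hl => lt_of_le_of_ne (normSqSum_nonneg _) (htle l hl).symm) hΘpos
    (fun j p hp => hℓ₀1.trans (hℓ j p hp)) hwt.pos hwt.le_one hκ (min_le_right _ _) hκΘ hK hC₁pos
    (fun p _ => hTnn p) hprod hCT (by rw [hwt.sum_eq]; ring)
  rw [rpow_two_mul_eq (derivedNorm_nonneg g z), hF0, hFM]
  simp only [hFQ0]
  refine inv_mul_rpow_le hM ?_ hC₁pos hC₂pos hΛnn hXle
  exact div_nonneg (mul_nonneg (Real.rpow_nonneg (normSqSum_nonneg _) _)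
    (prod_nonneg fun _ _ => normSqSum_nonneg _)) (prod_nonneg fun j _ => Real.rpow_nonneg
      (mul_nonneg (mul_nonneg (normSqSum_nonneg _) (hΘnn _ _))
        (prod_nonneg fun _ _ => sq_nonneg _)) _)
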